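/- Let $\mathbb{M}$ be a complete finite-dimensional smooth Riemannian manifold (every geodesic is defined on all of $\mathbb{R}$), with Riemannian distance $d$, Levi-Civita connection $\nabla$ and exponential maps $\exp_p$. For $p\in\mathbb{M}$ let $i_p\in(0,\infty]$ be the injectivity radius, i.e. the supremum of the $r>0$ for which $\exp_p$ restricted to the ball of radius $r$ about the origin of $T_p\mathbb{M}$ is a diffeomorphism onto its (open) image, and let $B_r(p)=\{q: d(p,q)<r\}$. Let $\Omega\subset\mathbb{M}$ be open, let $X$ be a differentiable vector field on $\Omega$, let $p_*\in\Omega$, and for $p\in\Omega$ let $\nabla X(p):T_p\mathbb{M}\to T_p\mathbb{M}$ be the linear map $v\mapsto\nabla_vX(p)$. For $p$ within the injectivity radius of $p_*$, let $P_{p_*p}:T_{p_*}\mathbb{M}\to T_p\mathbb{M}$ and $P_{pp_*}:T_p\mathbb{M}\to T_{p_*}\mathbb{M}$ be the parallel transports, in the two directions, along the geodesic segment $t\mapsto\exp_{p_*}(t\exp_{p_*}^{-1}p)$, $t\in[0,1]$, where $\exp_{p_*}^{-1}p$ is the vector of norm less than $i_{p_*}$ that $\exp_{p_*}$ maps to $p$.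 Linear maps between tangent spaces carry the operator norm of the Riemannian norms. Assume that $\nabla X$ is continuous at $p_*$. Then $$\lim_{p\to p_*}\left\|P_{pp_*}\,\nabla X(p)\,P_{p_*p}-\nabla X(p_*)\right\|=0 .$$ Moreover, if $\nabla X(p_*)$ is nonsingular, then there exists $0<\bar\delta<i_{p_*}$ such that $B_{\bar\delta}(p_*)\subset\Omega$ and, for each $p\in B_{\bar\delta}(p_*)$: (i) $\nabla X(p)$ is nonsingular; (ii) $\|\nabla X(p)^{-1}\|\le 2\,\|\nabla X(p_*)^{-1}\|$. -/

import Mathlib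

open Bundle Manifold Set Filter Topology
open scoped ContDiff ENNReal

set_option linter.unusedSectionVars false

section RiemannianNotions

variable {E : Type*} [NormedAddCommGroup E] [NormedSpace ℝ E] [FiniteDimensional ℝ E]
  {M : Type*} [TopologicalSpace M] [ChartedSpace E M] [IsManifold 𝓘(ℝ, E) ∞ M]
  [RiemannianBundle (fun x : M => TangentSpace 𝓘(ℝ, E) x)]
  [IsContMDiffRiemannianBundle 𝓘(ℝ, E) ∞ E (fun x : M => TangentSpace 𝓘(ℝ, E) x)]

theorem mdiff_inner {X Y : Π x : M, TangentSpace 𝓘(ℝ, E) x} {x : M}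
    (hX : MDiffAt (T% X) x) (hY : MDiffAt (T% Y) x) :
    MDiffAt (fun y => inner ℝ (X y) (Y y)) x :=
  MDifferentiableAt.inner_bundle (IB := 𝓘(ℝ, E)) (F := E)
    (E := fun x : M => TangentSpace 𝓘(ℝ, E) x) (b := id) hX hY

/-- The Koszul expression for `⟨∇_Y X, Z⟩` at `x`. -/
noncomputable def koszul (X Y Z : Π x : M, TangentSpace 𝓘(ℝ, E) x) (x : M) : ℝ :=
  (1 / 2) *
    ( d% (fun y => inner ℝ (X y) (Z y)) x (Y x)
    + d% (fun y => inner ℝ (Y y) (Z y)) x (X x)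
    - d% (fun y => inner ℝ (Y y) (X y)) x (Z x)
    + inner ℝ (VectorField.mlieBracket 𝓘(ℝ, E) Y X x) (Z x)
    - inner ℝ (VectorField.mlieBracket 𝓘(ℝ, E) Y Z x) (X x)
    - inner ℝ (VectorField.mlieBracket 𝓘(ℝ, E) X Z x) (Y x))

theorem koszul_tensorial_left {X : Π x : M, TangentSpace 𝓘(ℝ, E) x} {x : M}
    (hX : MDiffAt (T% X) x) (Z : Π x : M, TangentSpace 𝓘(ℝ, E) x) (hZ : MDiffAt (T% Z) x) :
    TensorialAt 𝓘(ℝ, E) E (fun Y => koszul X Y Z x) x where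
  smul {f Y} hf hY := by
    have h1 : (fun y => inner ℝ ((f • Y) y) (Z y)) = f * (fun y => inner ℝ (Y y) (Z y)) := by
      ext y; simp [inner_smul_left]
    have h2 : (fun y => inner ℝ ((f • Y) y) (X y)) = f * (fun y => inner ℝ (Y y) (X y)) := by
      ext y; simp [inner_smul_left]
    simp only [koszul, h1, h2, mvfderiv_mul hf (mdiff_inner hY hZ),
      mvfderiv_mul hf (mdiff_inner hY hX), VectorField.mlieBracket_smul_left hf hY]
    simp [inner_add_left, inner_smul_left, inner_smul_right, real_inner_comm]
    ring
  add {Y Y'} hY hY' := by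
    have h1 : (fun y => inner ℝ ((Y + Y') y) (Z y))
        = (fun y => inner ℝ (Y y) (Z y)) + (fun y => inner ℝ (Y' y) (Z y)) := by
      ext y; simp [inner_add_left]
    have h2 : (fun y => inner ℝ ((Y + Y') y) (X y))
        = (fun y => inner ℝ (Y y) (X y)) + (fun y => inner ℝ (Y' y) (X y)) := by
      ext y; simp [inner_add_left]
    simp only [koszul, h1, h2, mvfderiv_add (mdiff_inner hY hZ) (mdiff_inner hY' hZ),
      mvfderiv_add (mdiff_inner hY hX) (mdiff_inner hY' hX), VectorField.mlieBracket_add_left hY hY']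
    simp [inner_add_left, inner_add_right]
    ring

theorem koszul_tensorial_right {X : Π x : M, TangentSpace 𝓘(ℝ, E) x} {x : M}
    (hX : MDiffAt (T% X) x) (Y : Π x : M, TangentSpace 𝓘(ℝ, E) x) (hY : MDiffAt (T% Y) x) :
    TensorialAt 𝓘(ℝ, E) E (fun Z => koszul X Y Z x) x where
  smul {f Z} hf hZ := by
    have h1 : (fun y => inner ℝ (X y) ((f • Z) y)) = f * (fun y => inner ℝ (X y) (Z y)) := by
      ext y; simp [inner_smul_right]
    have h2 : (fun y => inner ℝ (Y y) ((f • Z) y)) = f * (fun y => inner ℝ (Y y) (Z y)) := by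
      ext y; simp [inner_smul_right]
    simp only [koszul, h1, h2, mvfderiv_mul hf (mdiff_inner hX hZ),
      mvfderiv_mul hf (mdiff_inner hY hZ), VectorField.mlieBracket_smul_right hf hZ]
    simp [inner_add_left, inner_smul_left, inner_smul_right, real_inner_comm]
    ring
  add {Z Z'} hZ hZ' := by
    have h1 : (fun y => inner ℝ (X y) ((Z + Z') y))
        = (fun y => inner ℝ (X y) (Z y)) + (fun y => inner ℝ (X y) (Z' y)) := by
      ext y; simp [inner_add_right]
    have h2 : (fun y => inner ℝ (Y y) ((Z + Z') y))
        = (fun y => inner ℝ (Y y) (Z y)) + (fun y => inner ℝ (Y y) (Z' y)) := by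
      ext y; simp [inner_add_right]
    simp only [koszul, h1, h2, mvfderiv_add (mdiff_inner hX hZ) (mdiff_inner hX hZ'),
      mvfderiv_add (mdiff_inner hY hZ) (mdiff_inner hY hZ'), VectorField.mlieBracket_add_right hZ hZ']
    simp [inner_add_left, inner_add_right]
    ring

open Classical in
/-- The bilinear form `(v, w) ↦ ⟨∇_v X, w⟩` on the tangent space at `x` given by the Koszul
expression (`0` if `X` is not differentiable at `x`). -/
noncomputable def koszulForm (X : Π x : M, TangentSpace 𝓘(ℝ, E) x) (x : M) :
    TangentSpace 𝓘(ℝ, E) x →L[ℝ] TangentSpace 𝓘(ℝ, E) x →L[ℝ] ℝ :=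
  if hX : MDiffAt (T% X) x then
    TensorialAt.mkHom₂ (fun Y Z => koszul X Y Z x) x
      (koszul_tensorial_left hX) (koszul_tensorial_right hX)
  else 0

theorem koszulForm_apply {X Y Z : Π x : M, TangentSpace 𝓘(ℝ, E) x} {x : M}
    (hX : MDiffAt (T% X) x) (hY : MDiffAt (T% Y) x) (hZ : MDiffAt (T% Z) x) :
    koszulForm X x (Y x) (Z x) = koszul X Y Z x := by
  rw [koszulForm, dif_pos hX]
  exact TensorialAt.mkHom₂_apply _ _ hY hZ

theorem exists_koszulCov (X : Π x : M, TangentSpace 𝓘(ℝ, E) x) (x : M) :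
    ∃ A : TangentSpace 𝓘(ℝ, E) x →L[ℝ] TangentSpace 𝓘(ℝ, E) x,
      ∀ v w, inner ℝ (A v) w = koszulForm X x v w := by
  have : FiniteDimensional ℝ (TangentSpace 𝓘(ℝ, E) x) := inferInstanceAs (FiniteDimensional ℝ E)
  have : CompleteSpace (TangentSpace 𝓘(ℝ, E) x) := FiniteDimensional.complete ℝ _
  refine ⟨LinearMap.toContinuousLinearMap
    { toFun := fun v => (InnerProductSpace.toDual ℝ (TangentSpace 𝓘(ℝ, E) x)).symm (koszulForm X x v)
      map_add' := by intro v w; simp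
      map_smul' := by intro c v; simp }, fun v w => ?_⟩
  simp

/-- The endomorphism `v ↦ ∇_v X` of the tangent space at `x`, obtained by representing
`koszulForm X x v` through the Riemannian inner product. -/
noncomputable def koszulCov (X : Π x : M, TangentSpace 𝓘(ℝ, E) x) (x : M) :
    TangentSpace 𝓘(ℝ, E) x →L[ℝ] TangentSpace 𝓘(ℝ, E) x :=
  (exists_koszulCov X x).choose

theorem inner_koszulCov {X Y Z : Π x : M, TangentSpace 𝓘(ℝ, E) x} {x : M}
    (hX : MDiffAt (T% X) x) (hY : MDiffAt (T% Y) x) (hZ : MDiffAt (T% Z) x) :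
    inner ℝ (koszulCov X x (Y x)) (Z x) = koszul X Y Z x := by
  rw [← koszulForm_apply hX hY hZ]
  exact (exists_koszulCov X x).choose_spec _ _

theorem clm_ext_fields {x : M} {A B : TangentSpace 𝓘(ℝ, E) x →L[ℝ] TangentSpace 𝓘(ℝ, E) x}
    (h : ∀ Y Z : Π x : M, TangentSpace 𝓘(ℝ, E) x, MDiffAt (T% Y) x → MDiffAt (T% Z) x →
      inner ℝ (A (Y x)) (Z x) = inner ℝ (B (Y x)) (Z x)) : A = B := by
  ext v
  refine ext_inner_right ℝ fun w => ?_
  have := h (FiberBundle.extend E v) (FiberBundle.extend E w)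
    (FiberBundle.mdifferentiableAt_extend ..) (FiberBundle.mdifferentiableAt_extend ..)
  simpa using this

theorem isCovariantDerivativeOn_koszulCov :
    IsCovariantDerivativeOn E (I := 𝓘(ℝ, E)) (M := M) (V := fun x : M => TangentSpace 𝓘(ℝ, E) x)
      koszulCov univ where
  add {X X' x} hX hX' _ := by
    refine clm_ext_fields fun Y Z hY hZ => ?_
    have h1 : (fun y => inner ℝ ((X + X') y) (Z y))
        = (fun y => inner ℝ (X y) (Z y)) + (fun y => inner ℝ (X' y) (Z y)) := by
      ext y; simp [inner_add_left]
    have h2 : (fun y => inner ℝ (Y y) ((X + X') y))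
        = (fun y => inner ℝ (Y y) (X y)) + (fun y => inner ℝ (Y y) (X' y)) := by
      ext y; simp [inner_add_right]
    rw [add_apply, inner_add_left, inner_koszulCov hX hY hZ,
      inner_koszulCov hX' hY hZ, inner_koszulCov (mdifferentiableAt_add_section hX hX') hY hZ]
    simp only [koszul, h1, h2, mvfderiv_add (mdiff_inner hX hZ) (mdiff_inner hX' hZ),
      mvfderiv_add (mdiff_inner hY hX) (mdiff_inner hY hX'),
      VectorField.mlieBracket_add_left hX hX', VectorField.mlieBracket_add_right hX hX']
    simp [inner_add_left, inner_add_right]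
    ring
  leibniz {X f x} hX hf _ := by
    refine clm_ext_fields fun Y Z hY hZ => ?_
    have h1 : (fun y => inner ℝ ((f • X) y) (Z y)) = f * (fun y => inner ℝ (X y) (Z y)) := by
      ext y; simp [inner_smul_left]
    have h2 : (fun y => inner ℝ (Y y) ((f • X) y)) = f * (fun y => inner ℝ (Y y) (X y)) := by
      ext y; simp [inner_smul_right]
    rw [add_apply, inner_add_left, smul_apply,
      real_inner_smul_left, inner_koszulCov hX hY hZ,
      inner_koszulCov (hf.smul_section hX) hY hZ]
    simp only [koszul, h1, h2, mvfderiv_mul hf (mdiff_inner hX hZ),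
      mvfderiv_mul hf (mdiff_inner hY hX),
      VectorField.mlieBracket_smul_left hf hX, VectorField.mlieBracket_smul_right hf hX]
    simp [inner_add_left, inner_smul_left, inner_smul_right, real_inner_comm]
    ring

variable (E M) in
/-- The Levi-Civita connection: `leviCivita E M X p v` is `(∇_v X)(p)`, so that
`leviCivita E M X p` is the linear map `∇X(p)`. It is metric (`leviCivita_metric`) and
torsion free (`leviCivita_torsion`). -/
noncomputable def leviCivita :
    CovariantDerivative 𝓘(ℝ, E) E (fun x : M => TangentSpace 𝓘(ℝ, E) x) where
  toFun := koszulCov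
  isCovariantDerivativeOnUniv := isCovariantDerivativeOn_koszulCov

theorem leviCivita_metric {X Y Z : Π x : M, TangentSpace 𝓘(ℝ, E) x} {x : M}
    (hX : MDiffAt (T% X) x) (hY : MDiffAt (T% Y) x) (hZ : MDiffAt (T% Z) x) :
    d% (fun y => inner ℝ (Y y) (Z y)) x (X x)
      = inner ℝ (leviCivita E M Y x (X x)) (Z x) + inner ℝ (Y x) (leviCivita E M Z x (X x)) := by
  have h1 : inner ℝ (leviCivita E M Y x (X x)) (Z x) = koszul Y X Z x := inner_koszulCov hY hX hZ
  have h2 : inner ℝ (Y x) (leviCivita E M Z x (X x)) = koszul Z X Y x := by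
    rw [real_inner_comm]; exact inner_koszulCov hZ hX hY
  simp only [h1, h2, koszul]
  rw [VectorField.mlieBracket_swap_apply (V := Z) (W := Y)]
  simp [real_inner_comm]
  ring

theorem leviCivita_torsion : (leviCivita E M).torsion = 0 := by
  rw [CovariantDerivative.torsion_eq_zero_iff]
  intro X Y x hX hY
  refine ext_inner_right ℝ fun w => ?_
  have hZ : MDiffAt (T% (FiberBundle.extend E w)) x := FiberBundle.mdifferentiableAt_extend ..
  have hw : FiberBundle.extend E w x = w := by simp
  rw [← hw]
  have h1 := inner_koszulCov hY hX hZ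
  have h2 := inner_koszulCov hX hY hZ
  rw [inner_sub_left]
  refine (congrArg₂ (· - ·) h1 h2).trans ?_
  simp only [koszul]
  rw [VectorField.mlieBracket_swap_apply (V := Y) (W := X)]
  simp [real_inner_comm]
  ring

variable (E) in
/-- The derivative `γ'(t)` (one-sided at the ends of `s`), as an element of the tangent bundle. -/
noncomputable def velocityWithin (γ : ℝ → M) (s : Set ℝ) (t : ℝ) : TangentBundle 𝓘(ℝ, E) M :=
  ⟨γ t, mfderivWithin 𝓘(ℝ, ℝ) 𝓘(ℝ, E) γ s t (1 : ℝ)⟩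

/-- The covariant derivative `DV/dt` of a vector field along a curve, the curve being
`τ ↦ (V τ).proj`. With respect to the coordinate frame `(eᵢ)` of the chart at the point
`(V t).proj` and `V = ∑ Vⁱ eᵢ` this is `∑ (Vⁱ)'(t) eᵢ + ∑ Vⁱ(t) ∇_{γ'(t)} eᵢ`: the first summand
below is the derivative of the components, and `FiberBundle.extend E (V t).2` is the field
`∑ Vⁱ(t) eᵢ` with constant components. -/
noncomputable def covDerivAlong (V : ℝ → TangentBundle 𝓘(ℝ, E) M) (s : Set ℝ) (t : ℝ) :
    TangentSpace 𝓘(ℝ, E) (V t).proj :=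
  (trivializationAt E (TangentSpace 𝓘(ℝ, E)) (V t).proj).symm (V t).proj
      (derivWithin (fun τ => (trivializationAt E (TangentSpace 𝓘(ℝ, E)) (V t).proj (V τ)).2) s t)
    + leviCivita E M (FiberBundle.extend E (V t).2) (V t).proj
        (velocityWithin E (fun τ => (V τ).proj) s t).2

/-- `V` is a differentiable vector field along `γ` on the interval `s` and it is parallel:
`∇_{γ'} V = 0`. -/
def IsParallelAlong (γ : ℝ → M) (V : ℝ → TangentBundle 𝓘(ℝ, E) M) (s : Set ℝ) : Prop :=
  (∀ t ∈ s, (V t).proj = γ t) ∧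
    MDifferentiableOn 𝓘(ℝ, ℝ) 𝓘(ℝ, E).tangent V s ∧
    ∀ t ∈ s, covDerivAlong V s t = 0

variable (E) in
/-- `γ : ℝ → M` is a geodesic: its velocity field is parallel. -/
def IsGeodesic (γ : ℝ → M) : Prop :=
  MDifferentiable 𝓘(ℝ, ℝ) 𝓘(ℝ, E) γ ∧ IsParallelAlong γ (velocityWithin E γ univ) univ

variable (E M) in
/-- Completeness: for each initial position and velocity there is a geodesic defined on all of `ℝ`. -/
def IsGeodesicallyComplete : Prop :=
  ∀ ξ : TangentBundle 𝓘(ℝ, E) M, ∃ γ : ℝ → M, IsGeodesic E γ ∧ velocityWithin E γ univ 0 = ξ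

open Classical in
/-- The exponential map: `exp_p v = γ(1)`, where `γ` is the geodesic with position `p` and velocity
`v` at time `0`. -/
noncomputable def expMap (p : M) (v : TangentSpace 𝓘(ℝ, E) p) : M :=
  if h : ∃ γ : ℝ → M, IsGeodesic E γ ∧
      velocityWithin E γ univ 0 = (⟨p, v⟩ : TangentBundle 𝓘(ℝ, E) M)
  then h.choose 1 else p

variable (E) in
/-- The injectivity radius at `p`: the supremum, possibly infinite, of the `r > 0` such that
`exp_p` is a diffeomorphism from the ball of radius `r` about the origin onto an open set. -/
noncomputable def injectivityRadius (p : M) : ℝ≥0∞ :=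
  sSup {ρ : ℝ≥0∞ | ∃ r : ℝ, 0 < r ∧ ρ = ENNReal.ofReal r ∧
    ∃ Φ : PartialDiffeomorph 𝓘(ℝ, TangentSpace 𝓘(ℝ, E) p) 𝓘(ℝ, E)
        (TangentSpace 𝓘(ℝ, E) p) M ∞,
      Φ.source = Metric.ball 0 r ∧ EqOn (expMap p) Φ (Metric.ball 0 r)}

open Classical in
variable (E) in
/-- `exp_p⁻¹ q`: the vector `v` of norm less than the injectivity radius at `p` with `exp_p v = q`
(for `q` within the injectivity radius of `p`; otherwise the default value is `0`). -/
noncomputable def expInv (p q : M) : TangentSpace 𝓘(ℝ, E) p :=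
  if h : ∃ v : TangentSpace 𝓘(ℝ, E) p, ‖v‖ₑ < injectivityRadius E p ∧ expMap p v = q
  then h.choose else 0

variable (E) in
/-- The geodesic segment `t ↦ exp_p (t exp_p⁻¹ q)`, `t ∈ [0, 1]`, from `p` to `q`, for `q` within
the injectivity radius of `p`. -/
noncomputable def normalGeodesic (p q : M) (t : ℝ) : M := expMap p (t • expInv E p q)

/-- `P` sends each `v` tangent at `p = γ a` to `V b`, where `V` is the parallel field along the
restriction of `γ` to the interval with end points `a` and `b` that satisfies `V a = v`.
Either order of `a` and `b` is allowed. -/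
def IsParallelTransport (γ : ℝ → M) (a b : ℝ) (p q : M)
    (P : TangentSpace 𝓘(ℝ, E) p →L[ℝ] TangentSpace 𝓘(ℝ, E) q) : Prop :=
  ∀ v, ∃ V, IsParallelAlong γ V (uIcc a b) ∧ V a = ⟨p, v⟩ ∧ V b = ⟨q, P v⟩

open Classical in
variable (E) in
/-- The parallel transport `P_{γ, a, b}` from the tangent space at `p = γ a` to the tangent space at
`q = γ b`. -/
noncomputable def parallelTransport (γ : ℝ → M) (a b : ℝ) (p q : M) :
    TangentSpace 𝓘(ℝ, E) p →L[ℝ] TangentSpace 𝓘(ℝ, E) q :=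
  if h : ∃ P, IsParallelTransport γ a b p q P then h.choose else 0

end RiemannianNotions

/-! Everything is read in the coordinate frame of the chart at `p₀`, where endomorphisms of
different tangent spaces become operators on `E`. Continuity of `∇X` at `p₀` says that these
operators converge. A parallel field has components solving the linear equation `w' = -Γ(w, γ')`,
with smooth Christoffel symbols (`contDiffOn_christoffel`). Along the segment from `p₀` to `p` the
velocity tends to `0` as `p → p₀`, so transport in either direction tends to the identity
(`eventually_norm_parallelTransport_sub_le`). The product of the three operators therefore tends to
that of `∇X(p₀)` (`tendsto_norm_parallelTransport_conj_sub`).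

The velocity bound requires that `exp` at `p₀` be, in the chart, a diffeomorphism near `0`. Smooth
dependence of geodesics on their initial velocity comes from the inverse function theorem in the
Banach space of continuous curves on `[0,1]` (`exists_smooth_geodesic_flow`). At zero velocity the
linearised integral equation is the identity minus an operator of square zero, hence invertible
without shortening the time interval. Uniqueness of geodesics (`IsGeodesic.eq_of_chart_solution`)
identifies this flow with `expMap`. It follows that the injectivity radius is positive and that
`expInv` is the local inverse (`exists_normalGeodesic_eq`).

The bound on the inverse needs no transport. Invertibility is an open condition and inversion is
continuous, so the operators in the frame behave well. The frame distorts the Riemannian norms at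
`p` and `p₀` relative to each other by a factor close to `1`, because the metric is continuous
(`eventually_isInvertible_norm_inverse_le`). -/

/-! ### Smoothness of postcomposition on spaces of continuous maps. -/

section Postcomposition

set_option synthInstance.maxHeartbeats 200000

universe u

variable {X : Type*} [TopologicalSpace X] [CompactSpace X]

/-- Pointwise evaluation of a continuous family of operators on a continuous family of vectors,
as a continuous bilinear map. -/
noncomputable def ContinuousMap.applyCLM (X : Type*) [TopologicalSpace X] [CompactSpace X]
    (E G : Type*) [NormedAddCommGroup E] [NormedSpace ℝ E]
    [NormedAddCommGroup G] [NormedSpace ℝ G] :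
    C(X, E →L[ℝ] G) →L[ℝ] C(X, E) →L[ℝ] C(X, G) :=
  LinearMap.mkContinuous₂
    (LinearMap.mk₂ ℝ (fun (A : C(X, E →L[ℝ] G)) (h : C(X, E)) => (⟨fun x => A x (h x), by fun_prop⟩ : C(X, G)))
      (fun _ _ _ => by ext; simp) (fun _ _ _ => by ext; simp)
      (fun _ _ _ => by ext; simp) (fun _ _ _ => by ext; simp)) 1
    (fun A h => by
      rw [one_mul]
      refine (ContinuousMap.norm_le _ (by positivity)).2 fun x => ?_
      exact (A x).le_of_opNorm_le_of_le (A.norm_coe_le_norm x) (h.norm_coe_le_norm x))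

variable {E G : Type*} [NormedAddCommGroup E] [NormedSpace ℝ E]
  [NormedAddCommGroup G] [NormedSpace ℝ G]

@[simp] theorem ContinuousMap.applyCLM_apply (A : C(X, E →L[ℝ] G)) (h : C(X, E)) (x : X) :
    ContinuousMap.applyCLM X E G A h x = A x (h x) := rfl

/-- Continuity of `w ↦ F' ∘ w` in the sup norm gives one radius on which `F'` varies by at most `ε`
around every point `z x`. The mean value inequality at each `x` is then uniform in `x`. -/
theorem ContinuousMap.hasFDerivAt_postcomp {F : C(E, G)} {F' : C(E, E →L[ℝ] G)}
    (hF : ∀ x, HasFDerivAt F (F' x) x) (z : C(X, E)) :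
    HasFDerivAt (fun w : C(X, E) => F.comp w)
      (ContinuousMap.applyCLM X E G (F'.comp z)) z := by
  rw [hasFDerivAt_iff_isLittleO_nhds_zero, Asymptotics.isLittleO_iff]
  intro ε hε
  have hcont : Continuous fun w : C(X, E) => F'.comp w := ContinuousMap.continuous_postcomp F'
  obtain ⟨δ, hδ, H⟩ := (Metric.continuousAt_iff
    (f := fun w : C(X, E) => F'.comp w)).1 hcont.continuousAt ε hε
  filter_upwards [Metric.ball_mem_nhds 0 hδ] with h hh
  rw [mem_ball_zero_iff] at hh
  refine (ContinuousMap.norm_le _ (by positivity)).2 fun x => ?_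
  have key : ∀ y ∈ Metric.ball (z x) δ, ‖F' y - F' (z x)‖ ≤ ε := by
    intro y hy
    -- Shifting `z` by a constant produces a map that is uniformly close to `z` and takes the value
    -- `y` at `x`.
    have h1 : dist (z + ContinuousMap.const X (y - z x)) z < δ := by
      rw [dist_eq_norm, add_sub_cancel_left]
      refine (ContinuousMap.norm_lt_iff _ hδ).2 fun x' => ?_
      simpa [dist_eq_norm] using hy
    have h2 := (ContinuousMap.dist_apply_le_dist x).trans (H h1).le
    simpa [dist_eq_norm] using h2
  have hx : ‖h x‖ < δ := (h.norm_coe_le_norm x).trans_lt hh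
  have := (convex_ball (z x) δ).norm_image_sub_le_of_norm_hasFDerivWithin_le'
    (fun y _ => (hF y).hasFDerivWithinAt) key (Metric.mem_ball_self hδ)
    (y := z x + h x) (by simpa [dist_eq_norm] using hx)
  simp only [add_sub_cancel_left] at this
  refine (le_trans ?_ this).trans (by gcongr; exact h.norm_coe_le_norm x)
  simp

/-- The derivative is again a postcomposition, with `F'`, followed by a continuous linear map, so
induction applies. The common universe of `E` and `G` lets the induction pass from `G` to `E →L[ℝ]
G`. -/
theorem ContinuousMap.contDiff_postcomp_nat {X : Type*} [TopologicalSpace X] [CompactSpace X]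
    (n : ℕ) {E G : Type u} [NormedAddCommGroup E] [NormedSpace ℝ E]
    [NormedAddCommGroup G] [NormedSpace ℝ G] {F : C(E, G)} (hF : ContDiff ℝ n F) :
    ContDiff ℝ n (fun w : C(X, E) => F.comp w) := by
  induction n generalizing G with
  | zero => exact contDiff_zero.2 (ContinuousMap.continuous_postcomp F)
  | succ n ih =>
    obtain ⟨F', hF', hd⟩ := contDiff_succ_iff_hasFDerivAt.1 hF
    refine contDiff_succ_iff_hasFDerivAt.2
      ⟨fun z => ContinuousMap.applyCLM X E G ((⟨F', hF'.continuous⟩ : C(E, E →L[ℝ] G)).comp z),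
        ?_, ContinuousMap.hasFDerivAt_postcomp hd⟩
    exact (ContinuousMap.applyCLM X E G).contDiff.comp
      (ih (F := ⟨F', hF'.continuous⟩) hF')

/-- Postcomposition with a smooth map is a smooth operator on spaces of continuous maps. -/
theorem ContinuousMap.contDiff_postcomp {X : Type*} [TopologicalSpace X] [CompactSpace X]
    {E G : Type u} [NormedAddCommGroup E] [NormedSpace ℝ E]
    [NormedAddCommGroup G] [NormedSpace ℝ G] {F : C(E, G)} (hF : ContDiff ℝ ∞ F) :
    ContDiff ℝ ∞ (fun w : C(X, E) => F.comp w) :=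
  contDiff_infty.2 fun n => ContinuousMap.contDiff_postcomp_nat n (contDiff_infty.1 hF n)

end Postcomposition

/-! ### The integration operator on continuous curves. -/

section Volterra

open intervalIntegral

variable {E : Type*} [NormedAddCommGroup E] [NormedSpace ℝ E]

/-- The operator sending `z` to its primitive vanishing at `0`. -/
noncomputable def volterra (E : Type*) [NormedAddCommGroup E] [NormedSpace ℝ E] :
    C(Icc (0 : ℝ) 1, E) →L[ℝ] C(Icc (0 : ℝ) 1, E) :=
  LinearMap.mkContinuous
    { toFun := fun z => ⟨fun t => ∫ s in (0 : ℝ)..t, z (projIcc 0 1 zero_le_one s),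
        (continuous_primitive (fun a b => (by fun_prop :
          Continuous fun s => z (projIcc 0 1 zero_le_one s)).intervalIntegrable a b) 0).comp
          continuous_subtype_val⟩
      map_add' := fun z w => by
        ext t
        exact integral_add (Continuous.intervalIntegrable (by fun_prop) _ _)
          (Continuous.intervalIntegrable (by fun_prop) _ _)
      map_smul' := fun c z => by
        ext t
        exact integral_smul c _ } 1
    (fun z => by
      rw [one_mul]
      refine (ContinuousMap.norm_le _ (norm_nonneg z)).2 fun t => ?_
      refine (norm_integral_le_of_norm_le_const (C := ‖z‖) fun s _ => z.norm_coe_le_norm _).trans ?_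
      have := t.2.1
      have := t.2.2
      rw [sub_zero, abs_of_nonneg t.2.1]
      exact mul_le_of_le_one_right (norm_nonneg z) t.2.2)

theorem volterra_apply (z : C(Icc (0 : ℝ) 1, E)) (t : Icc (0 : ℝ) 1) :
    volterra E z t = ∫ s in (0 : ℝ)..t, z (projIcc 0 1 zero_le_one s) := rfl

theorem hasDerivWithinAt_volterra [CompleteSpace E] (z : C(Icc (0 : ℝ) 1, E)) {t : ℝ}
    (ht : t ∈ Icc (0 : ℝ) 1) :
    HasDerivWithinAt (fun τ => volterra E z (projIcc 0 1 zero_le_one τ))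
      (z (projIcc 0 1 zero_le_one t)) (Icc 0 1) t := by
  have hc : Continuous fun s => z (projIcc 0 1 zero_le_one s) := by fun_prop
  have := (integral_hasDerivAt_right (hc.intervalIntegrable 0 t)
    hc.stronglyMeasurable.stronglyMeasurableAtFilter hc.continuousAt).hasDerivWithinAt
      (s := Icc (0 : ℝ) 1)
  refine this.congr_of_mem (fun τ hτ => ?_) ht
  rw [volterra_apply, projIcc_of_mem _ hτ]

theorem volterra_zero_apply (z : C(Icc (0 : ℝ) 1, E)) {t : Icc (0 : ℝ) 1} (ht : (t : ℝ) = 0) :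
    volterra E z t = 0 := by
  rw [volterra_apply, ht, integral_same]

end Volterra

/-! ### Smooth dependence of geodesics on the initial velocity, in a Banach space. -/

section SmoothFlow

universe u

variable {E : Type u} [NormedAddCommGroup E] [NormedSpace ℝ E]

/-- The first order form `(x, v) ↦ (v, -Γ(x)(v, v))` of the geodesic equation. -/
noncomputable def geodesicSpray (Γ : E → E →L[ℝ] E →L[ℝ] E) (z : E × E) : E × E :=
  (z.2, -Γ z.1 z.2 z.2)

theorem contDiff_geodesicSpray {Γ : E → E →L[ℝ] E →L[ℝ] E} (hΓ : ContDiff ℝ ∞ Γ) :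
    ContDiff ℝ ∞ (geodesicSpray Γ) := by
  unfold geodesicSpray
  have h : ContDiff ℝ ∞ fun z : E × E => Γ z.1 := hΓ.comp contDiff_fst
  exact contDiff_snd.prodMk ((h.clm_apply contDiff_snd).clm_apply contDiff_snd).neg

-- The acceleration is quadratic in the velocity, so it contributes nothing at zero velocity; the
-- nilpotent map `(x, v) ↦ (v, 0)` remains.
set_option synthInstance.maxHeartbeats 200000 in
theorem hasFDerivAt_geodesicSpray_zero {Γ : E → E →L[ℝ] E →L[ℝ] E} (hΓ : ContDiff ℝ ∞ Γ) (x₀ : E) :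
    HasFDerivAt (geodesicSpray Γ)
      ((ContinuousLinearMap.snd ℝ E E).prod (0 : E × E →L[ℝ] E)) (x₀, (0 : E)) := by
  have h : HasFDerivAt (fun z : E × E => Γ z.1) (fderiv ℝ (fun z : E × E => Γ z.1) (x₀, 0))
      (x₀, (0 : E)) :=
    (((hΓ.comp contDiff_fst).differentiable (by simp)).differentiableAt).hasFDerivAt
  have h2 : HasFDerivAt (fun z : E × E => z.2) (ContinuousLinearMap.snd ℝ E E) (x₀, (0 : E)) :=
    hasFDerivAt_snd
  have := h2.prodMk ((h.clm_apply h2).clm_apply h2).neg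
  refine this.congr_fderiv ?_
  refine ContinuousLinearMap.ext fun z => Prod.ext rfl ?_
  simp

variable [CompleteSpace E]

/-- `P` moves the second component to the first and kills the rest; integration preserves
components, so a second application of `P` gives zero. -/
theorem volterra_shift_sq (h : C(Icc (0 : ℝ) 1, E × E)) :
    let P := (((ContinuousLinearMap.snd ℝ E E).prod (0 : E × E →L[ℝ] E)).compLeftContinuous ℝ
      (Icc (0 : ℝ) 1))
    volterra (E × E) (P (volterra (E × E) (P h))) = 0 := by
  intro P
  have h2 : P (volterra (E × E) (P h)) = 0 := by
    ext1 t
    have : (volterra (E × E) (P h) t).2 = 0 := by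
      rw [volterra_apply]
      refine (ContinuousLinearMap.intervalIntegral_comp_comm (ContinuousLinearMap.snd ℝ E E)
          (Continuous.intervalIntegrable (by fun_prop) _ _)).symm.trans ?_
      exact intervalIntegral.integral_zero
    exact Prod.ext this rfl
  rw [h2, map_zero]

/-- The geodesic equation has a smooth time one map near the zero velocity, tangent to the
identity. -/
theorem exists_smooth_geodesic_flow {Γ : E → E →L[ℝ] E →L[ℝ] E} (hΓ : ContDiff ℝ ∞ Γ) (x₀ : E)
    {W : Set (E × E)} (hW : W ∈ 𝓝 (x₀, (0 : E))) :
    ∃ (U : Set E) (ζ : E → ℝ → E × E), IsOpen U ∧ (0 : E) ∈ U ∧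
      (∀ v ∈ U, ζ v 0 = (x₀, v) ∧ ∀ t ∈ Icc (0 : ℝ) 1, ζ v t ∈ W ∧
        HasDerivWithinAt (ζ v) (geodesicSpray Γ (ζ v t)) (Icc 0 1) t) ∧
      ContDiffOn ℝ ∞ (fun v => (ζ v 1).1) U ∧
      HasFDerivAt (fun v => (ζ v 1).1) (ContinuousLinearMap.id ℝ E) 0 ∧ (ζ 0 1).1 = x₀ := by
  set F : C(E × E, E × E) := ⟨geodesicSpray Γ, (contDiff_geodesicSpray hΓ).continuous⟩ with hFdef
  have hF : ContDiff ℝ ∞ F := contDiff_geodesicSpray hΓ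
  -- The integral form of the initial value problem reads `Φ z = const (x₀, v)`. Having `Γ` smooth
  -- on all of `E` makes `Φ` a smooth operator on the whole space of curves.
  set Φ : C(Icc (0 : ℝ) 1, E × E) → C(Icc (0 : ℝ) 1, E × E) :=
    fun z => z - volterra (E × E) (F.comp z) with hΦdef
  have hΦ : ContDiff ℝ ∞ Φ :=
    contDiff_id.sub ((volterra (E × E)).contDiff.comp (ContinuousMap.contDiff_postcomp hF))
  set P := (((ContinuousLinearMap.snd ℝ E E).prod (0 : E × E →L[ℝ] E)).compLeftContinuous ℝ
      (Icc (0 : ℝ) 1)) with hP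
  set N : C(Icc (0 : ℝ) 1, E × E) →L[ℝ] C(Icc (0 : ℝ) 1, E × E) := volterra (E × E) ∘L P with hN
  have hNN : ∀ h, N (N h) = 0 := volterra_shift_sq
  set z₀ : C(Icc (0 : ℝ) 1, E × E) := ContinuousMap.const _ (x₀, (0 : E)) with hz₀
  have hΦz₀ : Φ z₀ = z₀ := by
    have : F.comp z₀ = 0 := by
      ext1 t
      simp [F, z₀, geodesicSpray]
    simp only [hΦdef, this, map_zero, sub_zero]
  -- Since `N² = 0`, the Neumann series for the inverse of `1 - N` stops at `1 + N`.
  let D : C(Icc (0 : ℝ) 1, E × E) ≃L[ℝ] C(Icc (0 : ℝ) 1, E × E) :=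
    ContinuousLinearEquiv.equivOfInverse (ContinuousLinearMap.id ℝ _ - N)
      (ContinuousLinearMap.id ℝ _ + N) (fun h => by simp [hNN]) (fun h => by simp [hNN])
  have hD : HasFDerivAt Φ (D : C(Icc (0 : ℝ) 1, E × E) →L[ℝ] C(Icc (0 : ℝ) 1, E × E)) z₀ := by
    have h1 : ContDiff ℝ 1 F := hF.of_le (by simp)
    obtain ⟨F', hF', hd⟩ := contDiff_one_iff_hasFDerivAt.1 h1
    have h2 := ContinuousMap.hasFDerivAt_postcomp (F' := ⟨F', hF'⟩) hd z₀
    have h3 := (hasFDerivAt_id z₀).sub ((volterra (E × E)).hasFDerivAt.comp z₀ h2)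
    refine h3.congr_fderiv ?_
    have h4 : F' (x₀, 0) = (ContinuousLinearMap.snd ℝ E E).prod (0 : E × E →L[ℝ] E) :=
      (hd _).unique (hasFDerivAt_geodesicSpray_zero hΓ x₀)
    have h5 : ContinuousMap.applyCLM (Icc (0 : ℝ) 1) (E × E) (E × E)
        ((⟨F', hF'⟩ : C(E × E, E × E →L[ℝ] E × E)).comp z₀) = P := by
      ext1 h
      ext1 t
      rw [ContinuousMap.applyCLM_apply]
      simp [z₀, h4, P]
    rw [h5]
    rfl
  set e := hΦ.contDiffAt.toOpenPartialHomeomorph Φ hD (by simp) with he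
  have he_coe : ∀ z, e z = Φ z := fun z => rfl
  have hz₀s : z₀ ∈ e.source := hΦ.contDiffAt.mem_toOpenPartialHomeomorph_source hD (by simp)
  have hz₀t : z₀ ∈ e.target := by
    have := e.map_source hz₀s
    rwa [he_coe, hΦz₀] at this
  have hsymm₀ : e.symm z₀ = z₀ := by
    have := e.left_inv hz₀s
    rwa [he_coe, hΦz₀] at this
  -- the set of initial data
  obtain ⟨W', hW'W, hW'o, hW'm⟩ := mem_nhds_iff.1 hW
  have hdc : Continuous (fderiv ℝ Φ) := hΦ.continuous_fderiv (by simp)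
  -- Two open conditions: the curve stays in `W'`, and the derivative of `Φ` is still invertible
  -- there, which makes the local inverse smooth on a neighbourhood and not only at `z₀`.
  set S : Set C(Icc (0 : ℝ) 1, E × E) :=
    {z | MapsTo z univ W'} ∩ fderiv ℝ Φ ⁻¹' (range ((↑) : (C(Icc (0 : ℝ) 1, E × E) ≃L[ℝ]
      C(Icc (0 : ℝ) 1, E × E)) → _)) with hS
  have hSo : IsOpen S :=
    (ContinuousMap.isOpen_setOfPred_mapsTo isCompact_univ hW'o).inter
      (ContinuousLinearEquiv.isOpen.preimage hdc)
  have hz₀S : z₀ ∈ S := ⟨fun _ _ => hW'm, ⟨D, hD.fderiv.symm⟩⟩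
  set T := e.target ∩ e.symm ⁻¹' S with hT
  have hTo : IsOpen T := e.isOpen_inter_preimage_symm hSo
  set ι : E → C(Icc (0 : ℝ) 1, E × E) :=
    fun v => ContinuousLinearMap.const ℝ (Icc (0 : ℝ) 1) (x₀, v) with hι
  have hι0 : ι 0 = z₀ := rfl
  have hιs : ContDiff ℝ ∞ ι :=
    (ContinuousLinearMap.const ℝ (Icc (0 : ℝ) 1) : E × E →L[ℝ] _).contDiff.comp
      ((contDiff_const (c := x₀)).prodMk contDiff_id)
  have hsmooth : ∀ w ∈ T, ContDiffAt ℝ ∞ e.symm w := by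
    rintro w ⟨hw, -, ⟨D', hD'⟩⟩
    refine e.contDiffAt_symm hw (f₀' := D') ?_ hΦ.contDiffAt
    rw [hD']
    exact (hΦ.differentiable (by simp)).differentiableAt.hasFDerivAt
  have hz₀T : z₀ ∈ T := ⟨hz₀t, by rw [mem_preimage, hsymm₀]; exact hz₀S⟩
  let one : Icc (0 : ℝ) 1 := ⟨1, by simp⟩
  let ev : C(Icc (0 : ℝ) 1, E × E) →L[ℝ] E :=
    ContinuousLinearMap.fst ℝ E E ∘L ContinuousMap.evalCLM ℝ one
  have hp1 : projIcc (0 : ℝ) 1 zero_le_one 1 = one := projIcc_right _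
  refine ⟨ι ⁻¹' T, fun v t => e.symm (ι v) (projIcc 0 1 zero_le_one t), hTo.preimage hιs.continuous,
    by rw [mem_preimage, hι0]; exact hz₀T, fun v hv => ?_, ?_, ?_, ?_⟩
  · obtain ⟨hv1, hv2, -⟩ := hv
    have hsol : e.symm (ι v) - volterra (E × E) (F.comp (e.symm (ι v))) = ι v := e.right_inv hv1
    have hsol' : ∀ t, e.symm (ι v) t = (x₀, v) + volterra (E × E) (F.comp (e.symm (ι v))) t := by
      intro t
      have := congrArg (fun z : C(Icc (0 : ℝ) 1, E × E) => z t) hsol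
      simp only [ContinuousMap.sub_apply] at this
      rw [sub_eq_iff_eq_add] at this
      exact this
    refine ⟨?_, fun t ht => ⟨hW'W (hv2 (mem_univ _)), ?_⟩⟩
    · simp only
      rw [hsol', volterra_zero_apply _ (by simp), add_zero]
    · have := (hasDerivWithinAt_volterra (F.comp (e.symm (ι v))) ht).const_add (x₀, v)
      refine this.congr_of_mem (fun τ _ => hsol' _) ht
  · have : ContDiffOn ℝ ∞ (fun v => ev (e.symm (ι v))) (ι ⁻¹' T) := fun v hv =>
      (ev.contDiff.contDiffAt.comp v ((hsmooth _ hv).comp v hιs.contDiffAt)).contDiffWithinAt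
    simp only [hp1]
    exact this
  · have h1 : HasFDerivAt e.symm (D.symm : C(Icc (0 : ℝ) 1, E × E) →L[ℝ] _) z₀ :=
      e.hasFDerivAt_symm hz₀t (by rw [hsymm₀]; exact hD)
    have h2 : HasFDerivAt ι (ContinuousLinearMap.const ℝ (Icc (0 : ℝ) 1) ∘L
        (ContinuousLinearMap.inr ℝ E E)) 0 :=
      (ContinuousLinearMap.const ℝ (Icc (0 : ℝ) 1) : E × E →L[ℝ] _).hasFDerivAt.comp (0 : E)
        (hasFDerivAt_prodMk_right x₀ (0 : E))
    have h3 := ev.hasFDerivAt.comp (0 : E) ((hι0 ▸ h1 : HasFDerivAt e.symm _ (ι 0)).comp (0 : E) h2)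
    simp only [hp1]
    refine h3.congr_fderiv ?_
    ext v
    -- `D.symm = 1 + N` applied to the constant curve `(0, v)` has first component `0 + ∫ v = v` at
    -- time one.
    change (((ContinuousLinearMap.const ℝ (Icc (0 : ℝ) 1) ((0 : E), v)) one +
      volterra (E × E) (P (ContinuousLinearMap.const ℝ (Icc (0 : ℝ) 1) ((0 : E), v))) one)).1 = v
    rw [volterra_apply]
    simp [P, one]
  · simp only [hι0, hsymm₀]
    rfl

end SmoothFlow

/-! ### Fields with constant components and the Leibniz rule. -/

section ConstantFields

variable {E : Type*} [NormedAddCommGroup E] [NormedSpace ℝ E] [FiniteDimensional ℝ E]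
  {M : Type*} [TopologicalSpace M] [ChartedSpace E M] [IsManifold 𝓘(ℝ, E) ∞ M]

/-- The field with constant components `w` in the coordinate frame of the chart at `p₀`. -/
noncomputable def constField (p₀ : M) (w : E) (x : M) : TangentSpace 𝓘(ℝ, E) x :=
  (trivializationAt E (TangentSpace 𝓘(ℝ, E)) p₀).symmL ℝ x w

theorem trivializationAt_symmL_snd {p₀ x : M}
    (hx : x ∈ (trivializationAt E (TangentSpace 𝓘(ℝ, E)) p₀).baseSet) (w : E) :
    (trivializationAt E (TangentSpace 𝓘(ℝ, E)) p₀
      ⟨x, (trivializationAt E (TangentSpace 𝓘(ℝ, E)) p₀).symmL ℝ x w⟩).2 = w := by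
  rw [Trivialization.symmL_apply _ hx, Trivialization.apply_mk_symm _ hx]

theorem mdifferentiableAt_symmL_section {p₀ x : M}
    (hx : x ∈ (trivializationAt E (TangentSpace 𝓘(ℝ, E)) p₀).baseSet) {f : M → E}
    (hf : MDiffAt f x) :
    MDiffAt (T% (fun y => (trivializationAt E (TangentSpace 𝓘(ℝ, E)) p₀).symmL ℝ y (f y))) x := by
  rw [Trivialization.mdifferentiableAt_section_iff 𝓘(ℝ, E)
    (trivializationAt E (TangentSpace 𝓘(ℝ, E)) p₀) _ hx]
  refine hf.congr_of_eventuallyEq ?_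
  filter_upwards [(trivializationAt E (TangentSpace 𝓘(ℝ, E)) p₀).open_baseSet.mem_nhds hx]
    with y hy
  exact trivializationAt_symmL_snd hy _

theorem mdifferentiableAt_constField {p₀ x : M}
    (hx : x ∈ (trivializationAt E (TangentSpace 𝓘(ℝ, E)) p₀).baseSet) (w : E) :
    MDiffAt (T% (constField p₀ w)) x :=
  mdifferentiableAt_symmL_section hx mdifferentiableAt_const

variable (cov : CovariantDerivative 𝓘(ℝ, E) E (fun x : M => TangentSpace 𝓘(ℝ, E) x))

theorem CovariantDerivative.sum_smul {ι : Type*} (s : Finset ι) {g : ι → M → ℝ}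
    {σ : ι → Π x : M, TangentSpace 𝓘(ℝ, E) x} {x : M}
    (hg : ∀ i, MDiffAt (g i) x) (hσ : ∀ i, MDiffAt (T% (σ i)) x) :
    cov (∑ i ∈ s, g i • σ i) x =
      ∑ i ∈ s, (g i x • cov (σ i) x + (d% (g i) x).smulRight (σ i x)) := by
  classical
  induction s using Finset.induction_on with
  | empty => simp
  | insert a s ha ih =>
    rw [Finset.sum_insert ha, Finset.sum_insert ha, ← ih,
      cov.isCovariantDerivativeOnUniv.add ((hg a).smul_section (hσ a)) ?_ ,
      cov.isCovariantDerivativeOnUniv.leibniz (hσ a) (hg a)]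
    have := MDifferentiableAt.sum_section (s := s) (t := fun i => g i • σ i) (x₀ := x)
      (I := 𝓘(ℝ, E)) (F := E) (fun i _ => (hg i).smul_section (hσ i))
    convert this using 2
    simp

/-- The Leibniz rule for a field given by its components in the coordinate frame. -/
theorem CovariantDerivative.symmL_section {p₀ x : M}
    (hx : x ∈ (trivializationAt E (TangentSpace 𝓘(ℝ, E)) p₀).baseSet) {f : M → E}
    (hf : MDiffAt f x) (v : TangentSpace 𝓘(ℝ, E) x) :
    cov (fun y => (trivializationAt E (TangentSpace 𝓘(ℝ, E)) p₀).symmL ℝ y (f y)) x v =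
      (trivializationAt E (TangentSpace 𝓘(ℝ, E)) p₀).symmL ℝ x (mfderiv 𝓘(ℝ, E) 𝓘(ℝ, E) f x v)
        + cov (constField p₀ (f x)) x v := by
  -- A basis of `E` turns the `E`-valued `f` into real coefficients, for which the Leibniz rule is
  -- available.
  let b := Module.finBasis ℝ E
  let c : Fin _ → E →L[ℝ] ℝ := fun i => LinearMap.toContinuousLinearMap (b.coord i)
  have hc : ∀ w : E, w = ∑ i, c i w • b i := fun w => (b.sum_repr w).symm
  have hgen : ∀ g : M → E,
      (fun y => (trivializationAt E (TangentSpace 𝓘(ℝ, E)) p₀).symmL ℝ y (g y)) =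
        ∑ i, (fun y => c i (g y)) • constField p₀ (b i) := by
    intro g
    funext y
    conv_lhs => rw [hc (g y), map_sum]
    simp [Finset.sum_apply, constField]
  have hd : ∀ i, mfderiv 𝓘(ℝ, E) 𝓘(ℝ, ℝ) (fun y => c i (f y)) x v =
      c i (mfderiv 𝓘(ℝ, E) 𝓘(ℝ, E) f x v) := by
    intro i
    have h := (c i).hasMFDerivAt (x := f x)
    have h2 := (h.comp x hf.hasMFDerivAt).mfderiv
    exact congrArg (fun A => A v) h2
  have hdiff : ∀ i, MDiffAt (fun y => c i (f y)) x := fun i =>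
    ((c i).hasMFDerivAt (x := f x)).mdifferentiableAt.comp x hf
  have hconst : constField p₀ (f x) =
      ∑ i, (fun _ : M => c i (f x)) • constField p₀ (b i) := hgen fun _ => f x
  have hfield := fun i => mdifferentiableAt_constField hx (b i)
  rw [hgen f, hconst, cov.sum_smul _ hdiff hfield,
    cov.sum_smul _ (fun i => mdifferentiableAt_const) hfield]
  rw [hc (mfderiv 𝓘(ℝ, E) 𝓘(ℝ, E) f x v)]
  simp only [map_sum, ← hd]
  simp only [_root_.sum_apply, ← Finset.sum_add_distrib]
  refine Finset.sum_congr rfl fun i _ => ?_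
  simp only [mvfderiv, constField, add_apply, _root_.smul_apply,
    ContinuousLinearMap.smulRight_apply]
  refine (add_comm _ _).trans ?_
  simp
  exact (map_smul _ _ _).symm

end ConstantFields

/-! ### Independence of the chart for the covariant derivative along a curve. -/

section AlongCurves

variable {E : Type*} [NormedAddCommGroup E] [NormedSpace ℝ E] [FiniteDimensional ℝ E]
  {M : Type*} [TopologicalSpace M] [ChartedSpace E M] [IsManifold 𝓘(ℝ, E) ∞ M]
  [RiemannianBundle (fun x : M => TangentSpace 𝓘(ℝ, E) x)]
  [IsContMDiffRiemannianBundle 𝓘(ℝ, E) ∞ E (fun x : M => TangentSpace 𝓘(ℝ, E) x)]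

/-- The covariant derivative along a curve in the coordinate frame of any chart around the
point. -/
theorem covDerivAlong_eq {V : ℝ → TangentBundle 𝓘(ℝ, E) M} {s : Set ℝ} {t : ℝ}
    (hV : MDifferentiableWithinAt 𝓘(ℝ, ℝ) 𝓘(ℝ, E).tangent V s t) (hs : UniqueDiffWithinAt ℝ s t)
    {p₀ : M} (hp : (V t).proj ∈ (trivializationAt E (TangentSpace 𝓘(ℝ, E)) p₀).baseSet) :
    covDerivAlong V s t =
      (trivializationAt E (TangentSpace 𝓘(ℝ, E)) p₀).symmL ℝ (V t).proj
        (derivWithin (fun τ => (trivializationAt E (TangentSpace 𝓘(ℝ, E)) p₀ (V τ)).2) s t)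
      + leviCivita E M
          (constField p₀ (trivializationAt E (TangentSpace 𝓘(ℝ, E)) p₀ (V t)).2) (V t).proj
          (velocityWithin E (fun τ => (V τ).proj) s t).2 := by
  set x := (V t).proj with hx
  set e₀ := trivializationAt E (TangentSpace 𝓘(ℝ, E)) p₀ with he₀
  set e := trivializationAt E (TangentSpace 𝓘(ℝ, E)) x with he
  have hxe : x ∈ e.baseSet := FiberBundle.mem_baseSet_trivializationAt' x
  set w := (e₀ (V t)).2 with hw
  let v : TangentSpace 𝓘(ℝ, E) x := (velocityWithin E (fun τ => (V τ).proj) s t).2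
  -- differentiability of the curve and of its components
  have hγ : MDifferentiableWithinAt 𝓘(ℝ, ℝ) 𝓘(ℝ, E) (fun τ => (V τ).proj) s t :=
    ((mdifferentiableWithinAt_totalSpace 𝓘(ℝ, E) V).1 hV).1
  have hV₀ : DifferentiableWithinAt ℝ (fun τ => (e₀ (V τ)).2) s t :=
    ((Trivialization.mdifferentiableWithinAt_totalSpace_iff 𝓘(ℝ, E) e₀ V
      (e₀.mem_source.2 hp)).1 hV).2.differentiableWithinAt
  -- the coordinate change
  let c : M → E →L[ℝ] E := fun y => (e₀.coordChangeL ℝ e y : E →L[ℝ] E)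
  have hc : MDiffAt c x := mdifferentiableAt_coordChangeL hp hxe
  -- Components in the frame at `x` of the field that is constant in the frame at `p₀`. The
  -- derivative of `c` along the curve enters on both sides: through the product rule for the
  -- components of `V` in `hd1`, and through the Leibniz rule for this field in `hB`. This is why
  -- the two frames give the same result.
  let f : M → E := fun y => c y w
  have hf : MDiffAt f x := hc.clm_apply mdifferentiableAt_const
  have hcγ : DifferentiableWithinAt ℝ (fun τ => c (V τ).proj) s t :=
    (MDifferentiableAt.comp_mdifferentiableWithinAt (g := c) t hc hγ).differentiableWithinAt
  have hnhds : e₀.baseSet ∩ e.baseSet ∈ 𝓝 x :=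
    (e₀.open_baseSet.inter e.open_baseSet).mem_nhds ⟨hp, hxe⟩
  have hcomp : ∀ z : TangentBundle 𝓘(ℝ, E) M, z.proj ∈ e₀.baseSet ∩ e.baseSet →
      (e z).2 = c z.proj (e₀ z).2 := by
    rintro ⟨y, v⟩ hz
    change _ = e₀.coordChangeL ℝ e y _
    rw [Trivialization.coordChangeL_apply _ _ hz, Trivialization.symm_apply_apply_mk _ hz.1]
  have hsymm : ∀ y ∈ e₀.baseSet ∩ e.baseSet, ∀ u, e.symmL ℝ y (c y u) = e₀.symmL ℝ y u := by
    intro y hy u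
    change e.symmL ℝ y (e₀.coordChangeL ℝ e y u) = _
    rw [Trivialization.coordChangeL_apply _ _ hy, Trivialization.symmL_apply _ hy.2,
      Trivialization.symm_apply_apply_mk _ hy.2, Trivialization.symmL_apply _ hy.1]
  have hfx : f x = (e (V t)).2 := (hcomp _ ⟨hp, hxe⟩).symm
  -- the derivative of the components
  have hd1 : derivWithin (fun τ => (e (V τ)).2) s t =
      derivWithin (fun τ => c (V τ).proj) s t w + c x (derivWithin (fun τ => (e₀ (V τ)).2) s t) := by
    have h1 : HasDerivWithinAt (fun τ => c (V τ).proj ((e₀ (V τ)).2)) _ s t :=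
      hcγ.hasDerivWithinAt.clm_apply hV₀.hasDerivWithinAt
    have h2 : (fun τ => (e (V τ)).2) =ᶠ[𝓝[s] t] fun τ => c (V τ).proj ((e₀ (V τ)).2) := by
      filter_upwards [hγ.continuousWithinAt.preimage_mem_nhdsWithin hnhds] with τ hτ
      exact hcomp _ hτ
    rw [h2.derivWithin_eq (hcomp _ ⟨hp, hxe⟩), h1.derivWithin hs]
  have hd2 : mfderiv 𝓘(ℝ, E) 𝓘(ℝ, E) f x v =
      derivWithin (fun τ => c (V τ).proj) s t w := by
    have h1 : HasDerivWithinAt (fun τ => c (V τ).proj w) _ s t :=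
      hcγ.hasDerivWithinAt.clm_apply (hasDerivWithinAt_const t s w)
    have h2 := mfderiv_comp_mfderivWithin t hf hγ hs.uniqueMDiffWithinAt
    have h3 : mfderivWithin 𝓘(ℝ, ℝ) 𝓘(ℝ, E) (fun τ => c (V τ).proj w) s t (1 : ℝ) =
      derivWithin (fun τ => c (V τ).proj) s t w := by
      rw [mfderivWithin_eq_fderivWithin]
      refine (DFunLike.congr_fun (h1.hasFDerivWithinAt.fderivWithin hs) (1 : ℝ)).trans ?_
      simp
    rw [← h3]
    exact (congrArg (fun A => A (1 : ℝ)) h2).symm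
  have hfield : leviCivita E M (constField p₀ w) x =
      leviCivita E M (fun y => e.symmL ℝ y (f y)) x := by
    refine (leviCivita E M).isCovariantDerivativeOnUniv.congr_of_eventuallyEq
      (mdifferentiableAt_constField hp w) (mdifferentiableAt_symmL_section hxe hf) univ_mem ?_
    filter_upwards [hnhds] with y hy
    exact (hsymm y hy w).symm
  have hext : leviCivita E M (FiberBundle.extend E (V t).2) x =
      leviCivita E M (constField x (f x)) x := by
    refine (leviCivita E M).isCovariantDerivativeOnUniv.congr_of_eventuallyEq
      (FiberBundle.mdifferentiableAt_extend ..) (mdifferentiableAt_constField hxe _) univ_mem ?_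
    filter_upwards [e.open_baseSet.mem_nhds hxe] with y hy
    rw [hfx, constField, Trivialization.symmL_apply _ hy]
    rfl
  have hcov : covDerivAlong V s t = e.symmL ℝ x (derivWithin (fun τ => (e (V τ)).2) s t)
      + leviCivita E M (constField x (f x)) x v := by
    rw [← hext, Trivialization.symmL_apply _ hxe]
    rfl
  have hB : leviCivita E M (fun y => e.symmL ℝ y (f y)) x v =
      e.symmL ℝ x (mfderiv 𝓘(ℝ, E) 𝓘(ℝ, E) f x v) + leviCivita E M (constField x (f x)) x v :=
    (leviCivita E M).symmL_section hxe hf v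
  change _ = e₀.symmL ℝ x _ + leviCivita E M (constField p₀ w) x v
  rw [hcov, hd1, map_add, hsymm x ⟨hp, hxe⟩, hfield, hB, hd2]
  abel

end AlongCurves

/-! ### Smoothness of the Koszul expression in a chart. -/

section Christoffel

variable {E : Type*} [NormedAddCommGroup E] [NormedSpace ℝ E] [FiniteDimensional ℝ E]
  {M : Type*} [TopologicalSpace M] [ChartedSpace E M] [IsManifold 𝓘(ℝ, E) ∞ M]

theorem extChartAt_symm_mem_baseSet {p₀ : M} {y : E} (hy : y ∈ (extChartAt 𝓘(ℝ, E) p₀).target) :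
    (extChartAt 𝓘(ℝ, E) p₀).symm y ∈ (trivializationAt E (TangentSpace 𝓘(ℝ, E)) p₀).baseSet := by
  rw [TangentBundle.trivializationAt_baseSet, ← extChartAt_source 𝓘(ℝ, E)]
  exact (extChartAt 𝓘(ℝ, E) p₀).map_target hy

theorem contMDiffAt_constField {p₀ x : M}
    (hx : x ∈ (trivializationAt E (TangentSpace 𝓘(ℝ, E)) p₀).baseSet) (w : E) :
    CMDiffAt ∞ (T% (constField p₀ w)) x := by
  rw [Trivialization.contMDiffAt_section_iff
    (trivializationAt E (TangentSpace 𝓘(ℝ, E)) p₀) hx]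
  refine (contMDiffAt_const (c := w)).congr_of_eventuallyEq ?_
  filter_upwards [(trivializationAt E (TangentSpace 𝓘(ℝ, E)) p₀).open_baseSet.mem_nhds hx]
    with y hy
  exact trivializationAt_symmL_snd hy _

theorem contDiffAt_comp_extChartAt_symm {F : Type*} [NormedAddCommGroup F] [NormedSpace ℝ F]
    {p₀ : M} {y : E} (hy : y ∈ (extChartAt 𝓘(ℝ, E) p₀).target)
    {h : M → F} (hh : CMDiffAt ∞ h ((extChartAt 𝓘(ℝ, E) p₀).symm y)) :
    ContDiffAt ℝ ∞ (fun z => h ((extChartAt 𝓘(ℝ, E) p₀).symm z)) y := by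
  have h1 : CMDiffAt ∞ (extChartAt 𝓘(ℝ, E) p₀).symm y :=
    (contMDiffOn_extChartAt_symm p₀).contMDiffAt ((isOpen_extChartAt_target p₀).mem_nhds hy)
  exact (ContMDiffAt.comp y hh h1).contDiffAt

/-- The derivative along a constant field is a partial derivative. -/
theorem mvfderiv_constField {p₀ : M} {y : E} (hy : y ∈ (extChartAt 𝓘(ℝ, E) p₀).target)
    {h : M → ℝ} (hh : CMDiffAt ∞ h ((extChartAt 𝓘(ℝ, E) p₀).symm y)) (u : E) :
    d% h ((extChartAt 𝓘(ℝ, E) p₀).symm y) (constField p₀ u ((extChartAt 𝓘(ℝ, E) p₀).symm y)) =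
      fderiv ℝ (fun z => h ((extChartAt 𝓘(ℝ, E) p₀).symm z)) y u := by
  have hx := extChartAt_symm_mem_baseSet hy
  rw [TangentBundle.trivializationAt_baseSet] at hx
  have h1 : MDiffAt (extChartAt 𝓘(ℝ, E) p₀).symm y :=
    ((contMDiffOn_extChartAt_symm (n := ∞) p₀).contMDiffAt
      ((isOpen_extChartAt_target p₀).mem_nhds hy)).mdifferentiableAt (by simp)
  have h2 := mfderiv_comp y (hh.mdifferentiableAt (by simp)) h1
  rw [← mfderiv_eq_fderiv]
  refine Eq.trans ?_ (congrArg (fun A => A u) h2).symm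
  rw [constField, TangentBundle.symmL_trivializationAt hx]
  have hr : (extChartAt 𝓘(ℝ, E) p₀) ((extChartAt 𝓘(ℝ, E) p₀).symm y) = y :=
    (extChartAt 𝓘(ℝ, E) p₀).right_inv hy
  rw [modelWithCornersSelf_coe, range_id, mfderivWithin_univ]
  exact congrArg (fun z => d% h ((extChartAt 𝓘(ℝ, E) p₀).symm y)
    ((mfderiv 𝓘(ℝ, E) 𝓘(ℝ, E) (extChartAt 𝓘(ℝ, E) p₀).symm z : E →L[ℝ] E) u)) hr

variable [RiemannianBundle (fun x : M => TangentSpace 𝓘(ℝ, E) x)]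
  [IsContMDiffRiemannianBundle 𝓘(ℝ, E) ∞ E (fun x : M => TangentSpace 𝓘(ℝ, E) x)]

theorem contMDiffAt_inner_constField {p₀ x : M}
    (hx : x ∈ (trivializationAt E (TangentSpace 𝓘(ℝ, E)) p₀).baseSet) (u w : E) :
    CMDiffAt ∞ (fun y => inner ℝ (constField p₀ u y) (constField p₀ w y)) x :=
  ContMDiffAt.inner_bundle (IB := 𝓘(ℝ, E)) (F := E)
    (E := fun x : M => TangentSpace 𝓘(ℝ, E) x) (b := id)
    (contMDiffAt_constField hx u) (contMDiffAt_constField hx w)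

/-- The derivative terms are partial derivatives of the smooth metric coefficients. The bracket
terms are inner products of smooth fields, so there is no need to know that the brackets vanish. -/
theorem contDiffAt_koszul_constField {p₀ : M} {y : E} (hy : y ∈ (extChartAt 𝓘(ℝ, E) p₀).target)
    (u v w : E) :
    ContDiffAt ℝ ∞ (fun z => koszul (constField p₀ u) (constField p₀ v) (constField p₀ w)
      ((extChartAt 𝓘(ℝ, E) p₀).symm z)) y := by
  have hder : ∀ a b c : E, ContDiffAt ℝ ∞ (fun z =>
      d% (fun x => inner ℝ (constField p₀ a x) (constField p₀ b x))
        ((extChartAt 𝓘(ℝ, E) p₀).symm z) (constField p₀ c ((extChartAt 𝓘(ℝ, E) p₀).symm z))) y := by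
    intro a b c
    have h1 : ContDiffAt ℝ ∞ (fun z => fderiv ℝ (fun z' =>
        inner ℝ (constField p₀ a ((extChartAt 𝓘(ℝ, E) p₀).symm z'))
          (constField p₀ b ((extChartAt 𝓘(ℝ, E) p₀).symm z'))) z c) y :=
      ((contDiffAt_comp_extChartAt_symm hy (contMDiffAt_inner_constField
        (extChartAt_symm_mem_baseSet hy) a b)).fderiv_right (m := ∞) (by simp)).clm_apply
          contDiffAt_const
    refine h1.congr_of_eventuallyEq ?_
    filter_upwards [(isOpen_extChartAt_target p₀).mem_nhds hy] with z hz
    exact mvfderiv_constField hz (contMDiffAt_inner_constField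
      (extChartAt_symm_mem_baseSet hz) a b) c
  have hbr : ∀ a b c : E, ContDiffAt ℝ ∞ (fun z =>
      inner ℝ (VectorField.mlieBracket 𝓘(ℝ, E) (constField p₀ a) (constField p₀ b)
        ((extChartAt 𝓘(ℝ, E) p₀).symm z)) (constField p₀ c ((extChartAt 𝓘(ℝ, E) p₀).symm z))) y := by
    intro a b c
    refine contDiffAt_comp_extChartAt_symm hy (h := fun x => inner ℝ
      (VectorField.mlieBracket 𝓘(ℝ, E) (constField p₀ a) (constField p₀ b) x)
        (constField p₀ c x)) ?_
    have hx := extChartAt_symm_mem_baseSet hy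
    have : IsManifold 𝓘(ℝ, E) (minSmoothness ℝ 2) M := by
      rw [minSmoothness_of_isRCLikeNormedField]; infer_instance
    have : IsManifold 𝓘(ℝ, E) (((⊤ : ℕ∞) : ℕ∞ω) + 1) M := inferInstanceAs (IsManifold 𝓘(ℝ, E) ∞ M)
    have h2 := ContMDiffAt.mlieBracket_vectorField (m := ⊤) (n := ⊤)
      (contMDiffAt_constField hx a) (contMDiffAt_constField hx b) (by simp)
    exact ContMDiffAt.inner_bundle (IB := 𝓘(ℝ, E)) (F := E)
      (E := fun x : M => TangentSpace 𝓘(ℝ, E) x) (b := id) h2 (contMDiffAt_constField hx c)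
  unfold koszul
  exact contDiffAt_const.mul ((((((hder _ _ _).add (hder _ _ _)).sub (hder _ _ _)).add
    (hbr _ _ _)).sub (hbr _ _ _)).sub (hbr _ _ _))

end Christoffel

/-! ### Smoothness of the Christoffel symbols. -/

section ChristoffelSmooth

variable {E : Type*} [NormedAddCommGroup E] [NormedSpace ℝ E] [FiniteDimensional ℝ E]
  {M : Type*} [TopologicalSpace M] [ChartedSpace E M] [IsManifold 𝓘(ℝ, E) ∞ M]
  [RiemannianBundle (fun x : M => TangentSpace 𝓘(ℝ, E) x)]
  [IsContMDiffRiemannianBundle 𝓘(ℝ, E) ∞ E (fun x : M => TangentSpace 𝓘(ℝ, E) x)]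

/-- The components of `v ↦ ∇_v (constField p₀ w)` at `x` in the chart at `p₀`. -/
noncomputable def christoffelAux (p₀ x : M) (w : E) : E →L[ℝ] E :=
  (trivializationAt E (TangentSpace 𝓘(ℝ, E)) p₀).continuousLinearMapAt ℝ x ∘L
    (leviCivita E M (constField p₀ w) x ∘L
      (trivializationAt E (TangentSpace 𝓘(ℝ, E)) p₀).symmL ℝ x)

variable (E) in
/-- The Christoffel symbols in the chart at `p₀`, as a bilinear map: `christoffel E p₀ x w u` has the
components of `∇_u w` for constant fields `u` and `w`. -/
noncomputable def christoffel (p₀ x : M) : E →L[ℝ] E →L[ℝ] E :=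
  LinearMap.toContinuousLinearMap
    ((Module.finBasis ℝ E).constr ℝ fun i => christoffelAux p₀ x (Module.finBasis ℝ E i))

/-- `christoffel` is linear in `w` by construction, as an extension from a basis. It gives the right
value for every `w` because the connection is linear on differentiable fields. -/
theorem christoffel_apply {p₀ x : M}
    (hx : x ∈ (trivializationAt E (TangentSpace 𝓘(ℝ, E)) p₀).baseSet) (w : E) :
    christoffel E p₀ x w = christoffelAux p₀ x w := by
  have h1 : constField p₀ w = ∑ i, (fun _ : M => (Module.finBasis ℝ E).repr w i) •
      constField p₀ (Module.finBasis ℝ E i) := by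
    funext y
    conv_lhs => rw [← (Module.finBasis ℝ E).sum_repr w, constField, map_sum]
    simp [Finset.sum_apply, constField]
  ext u
  simp only [christoffel, LinearMap.coe_toContinuousLinearMap', Module.Basis.constr_apply_fintype,
    christoffelAux, ContinuousLinearMap.comp_apply]
  rw [h1, (leviCivita E M).sum_smul _ (fun i => mdifferentiableAt_const)
    (fun i => mdifferentiableAt_constField hx _)]
  simp [mvfderiv]

theorem symmL_christoffel {p₀ x : M}
    (hx : x ∈ (trivializationAt E (TangentSpace 𝓘(ℝ, E)) p₀).baseSet) (w u : E) :
    (trivializationAt E (TangentSpace 𝓘(ℝ, E)) p₀).symmL ℝ x (christoffel E p₀ x w u) =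
      leviCivita E M (constField p₀ w) x (constField p₀ u x) := by
  rw [christoffel_apply hx, christoffelAux, ContinuousLinearMap.comp_apply,
    Trivialization.symmL_continuousLinearMapAt _ hx]
  rfl

variable (E) in
/-- The matrix of the metric in the chart at `p₀`. -/
noncomputable def chartMetric (p₀ x : M) : E →L[ℝ] E →L[ℝ] ℝ :=
  LinearMap.toContinuousLinearMap
    { toFun := fun u => innerSL ℝ (constField p₀ u x) ∘L
        (trivializationAt E (TangentSpace 𝓘(ℝ, E)) p₀).symmL ℝ x
      map_add' := fun u v => by ext; simp [constField]
      map_smul' := fun c v => by ext; simp [constField] }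

theorem chartMetric_apply (p₀ x : M) (u w : E) :
    chartMetric E p₀ x u w = inner ℝ (constField p₀ u x) (constField p₀ w x) := rfl

/-- Positive definiteness gives injectivity; `E` and its dual have the same dimension. -/
theorem chartMetric_isInvertible {p₀ x : M}
    (hx : x ∈ (trivializationAt E (TangentSpace 𝓘(ℝ, E)) p₀).baseSet) :
    ∃ G : E ≃L[ℝ] (E →L[ℝ] ℝ), (G : E →L[ℝ] E →L[ℝ] ℝ) = chartMetric E p₀ x := by
  have hinj : Function.Injective ((chartMetric E p₀ x : E →L[ℝ] E →L[ℝ] ℝ) : E →ₗ[ℝ] E →L[ℝ] ℝ) := by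
    rw [← LinearMap.ker_eq_bot, LinearMap.ker_eq_bot']
    intro u hu
    have h1 : chartMetric E p₀ x u u = 0 := by
      rw [show chartMetric E p₀ x u = 0 from hu]; rfl
    rw [chartMetric_apply, inner_self_eq_zero] at h1
    have h2 := trivializationAt_symmL_snd hx u
    have h3 := trivializationAt_symmL_snd hx (0 : E)
    rw [map_zero] at h3
    rw [← h2, show (trivializationAt E (TangentSpace 𝓘(ℝ, E)) p₀).symmL ℝ x u = 0 from h1, h3]
  have hrank : Module.finrank ℝ E = Module.finrank ℝ (E →L[ℝ] ℝ) := by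
    rw [← (LinearMap.toContinuousLinearMap : (E →ₗ[ℝ] ℝ) ≃ₗ[ℝ] (E →L[ℝ] ℝ)).finrank_eq]
    exact (Subspace.dual_finrank_eq).symm
  refine ⟨(LinearMap.linearEquivOfInjective _ hinj hrank).toContinuousLinearEquiv, ?_⟩
  ext u w
  rfl

theorem contDiffAt_chartMetric {p₀ : M} {y : E} (hy : y ∈ (extChartAt 𝓘(ℝ, E) p₀).target) :
    ContDiffAt ℝ ∞ (fun z => chartMetric E p₀ ((extChartAt 𝓘(ℝ, E) p₀).symm z)) y := by
  have : ContDiffOn ℝ ∞ (fun z => chartMetric E p₀ ((extChartAt 𝓘(ℝ, E) p₀).symm z))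
      (extChartAt 𝓘(ℝ, E) p₀).target := by
    refine contDiffOn_clm_apply.2 fun u => contDiffOn_clm_apply.2 fun w z hz => ?_
    exact (contDiffAt_comp_extChartAt_symm hz (contMDiffAt_inner_constField
      (extChartAt_symm_mem_baseSet hz) u w)).contDiffWithinAt
  exact this.contDiffAt ((isOpen_extChartAt_target p₀).mem_nhds hy)

theorem chartMetric_christoffel {p₀ x : M}
    (hx : x ∈ (trivializationAt E (TangentSpace 𝓘(ℝ, E)) p₀).baseSet) (w u v : E) :
    chartMetric E p₀ x (christoffel E p₀ x w u) v =
      koszul (constField p₀ w) (constField p₀ u) (constField p₀ v) x := by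
  rw [chartMetric_apply, constField, symmL_christoffel hx]
  exact inner_koszulCov (mdifferentiableAt_constField hx w) (mdifferentiableAt_constField hx u)
    (mdifferentiableAt_constField hx v)

-- By the Koszul formula the metric applied to the symbols is smooth. The metric is smooth with
-- invertible values and inversion of operators is smooth, so the symbols can be solved for.
set_option synthInstance.maxHeartbeats 200000 in
theorem contDiffOn_christoffel (p₀ : M) :
    ContDiffOn ℝ ∞ (fun z => christoffel E p₀ ((extChartAt 𝓘(ℝ, E) p₀).symm z))
      (extChartAt 𝓘(ℝ, E) p₀).target := by
  refine contDiffOn_clm_apply.2 fun w => contDiffOn_clm_apply.2 fun u y hy => ?_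
  have hK : ContDiffOn ℝ ∞ (fun z => chartMetric E p₀ ((extChartAt 𝓘(ℝ, E) p₀).symm z)
      (christoffel E p₀ ((extChartAt 𝓘(ℝ, E) p₀).symm z) w u)) (extChartAt 𝓘(ℝ, E) p₀).target := by
    refine contDiffOn_clm_apply.2 fun v => ?_
    refine ContDiffOn.congr (f := fun z => koszul (constField p₀ w) (constField p₀ u)
      (constField p₀ v) ((extChartAt 𝓘(ℝ, E) p₀).symm z))
      (fun z hz => (contDiffAt_koszul_constField hz w u v).contDiffWithinAt) fun z hz => ?_
    exact chartMetric_christoffel (extChartAt_symm_mem_baseSet hz) w u v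
  have hK' := hK.contDiffAt ((isOpen_extChartAt_target p₀).mem_nhds hy)
  have hinv : ContDiffAt ℝ ∞ (fun z => ContinuousLinearMap.inverse
      (chartMetric E p₀ ((extChartAt 𝓘(ℝ, E) p₀).symm z))) y := by
    obtain ⟨G, hG⟩ := chartMetric_isInvertible (extChartAt_symm_mem_baseSet hy)
    have h1 : ContDiffAt ℝ ∞ ContinuousLinearMap.inverse
        (chartMetric E p₀ ((extChartAt 𝓘(ℝ, E) p₀).symm y)) := hG ▸ contDiffAt_map_inverse G
    exact h1.comp y (contDiffAt_chartMetric hy)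
  refine ContDiffAt.contDiffWithinAt ((hinv.clm_apply hK').congr_of_eventuallyEq ?_)
  filter_upwards [(isOpen_extChartAt_target p₀).mem_nhds hy] with z hz
  obtain ⟨G, hG⟩ := chartMetric_isInvertible (extChartAt_symm_mem_baseSet hz)
  rw [← hG, ContinuousLinearMap.inverse_equiv]
  simp

end ChristoffelSmooth

/-! ### Parallel fields as solutions of a linear equation in the chart. -/

section ParallelInChart

variable {E : Type*} [NormedAddCommGroup E] [NormedSpace ℝ E] [FiniteDimensional ℝ E]
  {M : Type*} [TopologicalSpace M] [ChartedSpace E M] [IsManifold 𝓘(ℝ, E) ∞ M]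

/-- The chain rule, since the trivialization at `p₀` is fibrewise the differential of the chart at
`p₀`. -/
theorem hasDerivWithinAt_extChartAt_comp {γ : ℝ → M} {s : Set ℝ} {t : ℝ} {p₀ : M}
    (hγ : MDifferentiableWithinAt 𝓘(ℝ, ℝ) 𝓘(ℝ, E) γ s t)
    (hp : γ t ∈ (trivializationAt E (TangentSpace 𝓘(ℝ, E)) p₀).baseSet) :
    HasDerivWithinAt (fun τ => extChartAt 𝓘(ℝ, E) p₀ (γ τ))
      (trivializationAt E (TangentSpace 𝓘(ℝ, E)) p₀ (velocityWithin E γ s t)).2 s t := by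
  have hp' := hp
  rw [TangentBundle.trivializationAt_baseSet] at hp'
  have h1 : HasMFDerivAt 𝓘(ℝ, E) 𝓘(ℝ, E) (extChartAt 𝓘(ℝ, E) p₀) (γ t)
      (mfderiv 𝓘(ℝ, E) 𝓘(ℝ, E) (extChartAt 𝓘(ℝ, E) p₀) (γ t)) :=
    (mdifferentiableAt_extChartAt hp').hasMFDerivAt
  let A : ℝ →L[ℝ] E := (mfderiv 𝓘(ℝ, E) 𝓘(ℝ, E) (extChartAt 𝓘(ℝ, E) p₀) (γ t)).comp
    (mfderivWithin 𝓘(ℝ, ℝ) 𝓘(ℝ, E) γ s t)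
  have h2 : HasFDerivWithinAt (fun τ => extChartAt 𝓘(ℝ, E) p₀ (γ τ)) A s t :=
    (h1.comp_hasMFDerivWithinAt t hγ.hasMFDerivWithinAt).hasFDerivWithinAt
  have h3 := h2.hasDerivWithinAt
  refine h3.congr_deriv ?_
  have h4 := (trivializationAt E (TangentSpace 𝓘(ℝ, E)) p₀).continuousLinearMapAt_apply_of_mem ℝ hp
    (mfderivWithin 𝓘(ℝ, ℝ) 𝓘(ℝ, E) γ s t (1 : ℝ))
  rw [TangentBundle.continuousLinearMapAt_trivializationAt hp'] at h4
  exact h4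

variable [RiemannianBundle (fun x : M => TangentSpace 𝓘(ℝ, E) x)]
  [IsContMDiffRiemannianBundle 𝓘(ℝ, E) ∞ E (fun x : M => TangentSpace 𝓘(ℝ, E) x)]

/-- All fibres are copies of `E`, so vectors over propositionally equal base points can be compared
without casts. -/
theorem tangentBundle_mk_congr {x y : M} (h : x = y) {u v : E} (huv : u = v) :
    (TotalSpace.mk' E x u : TangentBundle 𝓘(ℝ, E) M) = TotalSpace.mk' E y v := by
  subst h huv
  rfl

theorem velocityWithin_congr {γ γ' : ℝ → M} {s : Set ℝ} {t : ℝ} (h : EqOn γ' γ s) (ht : t ∈ s) :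
    velocityWithin E γ' s t = velocityWithin E γ s t := by
  have h1 : mfderivWithin 𝓘(ℝ, ℝ) 𝓘(ℝ, E) γ' s t = mfderivWithin 𝓘(ℝ, ℝ) 𝓘(ℝ, E) γ s t :=
    mfderivWithin_congr h (h ht)
  exact tangentBundle_mk_congr (h ht) (congrArg (fun A : ℝ →L[ℝ] E => A 1) h1)

theorem covDerivAlong_eq_symmL {γ : ℝ → M} {V : ℝ → TangentBundle 𝓘(ℝ, E) M} {s : Set ℝ} {t : ℝ}
    (hVγ : ∀ τ ∈ s, (V τ).proj = γ τ) (ht : t ∈ s)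
    (hV : MDifferentiableWithinAt 𝓘(ℝ, ℝ) 𝓘(ℝ, E).tangent V s t) (hs : UniqueDiffWithinAt ℝ s t)
    {p₀ : M} (hp : γ t ∈ (trivializationAt E (TangentSpace 𝓘(ℝ, E)) p₀).baseSet) :
    covDerivAlong V s t = (trivializationAt E (TangentSpace 𝓘(ℝ, E)) p₀).symmL ℝ (V t).proj
      (derivWithin (fun τ => (trivializationAt E (TangentSpace 𝓘(ℝ, E)) p₀ (V τ)).2) s t
        + christoffel E p₀ (γ t) (trivializationAt E (TangentSpace 𝓘(ℝ, E)) p₀ (V t)).2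
          (trivializationAt E (TangentSpace 𝓘(ℝ, E)) p₀ (velocityWithin E γ s t)).2) := by
  have hp' : (V t).proj ∈ (trivializationAt E (TangentSpace 𝓘(ℝ, E)) p₀).baseSet := by
    rwa [hVγ t ht]
  rw [covDerivAlong_eq hV hs hp', map_add, ← velocityWithin_congr hVγ ht, ← hVγ t ht,
    symmL_christoffel hp', constField]
  congr 2
  rw [Trivialization.symmL_apply _ hp']
  exact (Trivialization.symm_apply_apply_mk _ hp' _).symm

/-- The frame is injective on each fibre over the base set, so the covariant derivative vanishes
exactly when its components do. -/
theorem covDerivAlong_eq_zero_iff {γ : ℝ → M} {V : ℝ → TangentBundle 𝓘(ℝ, E) M} {s : Set ℝ} {t : ℝ}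
    (hVγ : ∀ τ ∈ s, (V τ).proj = γ τ) (ht : t ∈ s)
    (hV : MDifferentiableWithinAt 𝓘(ℝ, ℝ) 𝓘(ℝ, E).tangent V s t) (hs : UniqueDiffWithinAt ℝ s t)
    {p₀ : M} (hp : γ t ∈ (trivializationAt E (TangentSpace 𝓘(ℝ, E)) p₀).baseSet) :
    covDerivAlong V s t = 0 ↔
      HasDerivWithinAt (fun τ => (trivializationAt E (TangentSpace 𝓘(ℝ, E)) p₀ (V τ)).2)
        (-christoffel E p₀ (γ t) (trivializationAt E (TangentSpace 𝓘(ℝ, E)) p₀ (V t)).2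
          (trivializationAt E (TangentSpace 𝓘(ℝ, E)) p₀ (velocityWithin E γ s t)).2) s t := by
  have hp' : (V t).proj ∈ (trivializationAt E (TangentSpace 𝓘(ℝ, E)) p₀).baseSet := by
    rwa [hVγ t ht]
  have hd : DifferentiableWithinAt ℝ
      (fun τ => (trivializationAt E (TangentSpace 𝓘(ℝ, E)) p₀ (V τ)).2) s t :=
    ((Trivialization.mdifferentiableWithinAt_totalSpace_iff 𝓘(ℝ, E)
      (trivializationAt E (TangentSpace 𝓘(ℝ, E)) p₀) V
      ((trivializationAt E (TangentSpace 𝓘(ℝ, E)) p₀).mem_source.2 hp')).1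
        hV).2.differentiableWithinAt
  rw [covDerivAlong_eq_symmL hVγ ht hV hs hp]
  constructor
  · intro h
    have h1 := trivializationAt_symmL_snd hp' (derivWithin (fun τ =>
        (trivializationAt E (TangentSpace 𝓘(ℝ, E)) p₀ (V τ)).2) s t
        + christoffel E p₀ (γ t) (trivializationAt E (TangentSpace 𝓘(ℝ, E)) p₀ (V t)).2
          (trivializationAt E (TangentSpace 𝓘(ℝ, E)) p₀ (velocityWithin E γ s t)).2)
    have h2 := trivializationAt_symmL_snd hp' (0 : E)
    rw [map_zero] at h2
    rw [h, h2, eq_comm] at h1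
    rw [← eq_neg_of_add_eq_zero_left h1]
    exact hd.hasDerivWithinAt
  · intro h
    rw [h.derivWithin hs]
    simp

theorem IsParallelAlong.hasDerivWithinAt {γ : ℝ → M} {V : ℝ → TangentBundle 𝓘(ℝ, E) M} {s : Set ℝ}
    (h : IsParallelAlong γ V s) {t : ℝ} (ht : t ∈ s) (hs : UniqueDiffWithinAt ℝ s t)
    {p₀ : M} (hp : γ t ∈ (trivializationAt E (TangentSpace 𝓘(ℝ, E)) p₀).baseSet) :
    HasDerivWithinAt (fun τ => (trivializationAt E (TangentSpace 𝓘(ℝ, E)) p₀ (V τ)).2)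
        (-christoffel E p₀ (γ t) (trivializationAt E (TangentSpace 𝓘(ℝ, E)) p₀ (V t)).2
          (trivializationAt E (TangentSpace 𝓘(ℝ, E)) p₀ (velocityWithin E γ s t)).2) s t :=
  (covDerivAlong_eq_zero_iff h.1 ht (h.2.1 t ht) hs hp).1 (h.2.2 t ht)

theorem isParallelAlong_symmL {γ : ℝ → M} {s : Set ℝ} (hs : UniqueDiffOn ℝ s) {p₀ : M}
    (hγ : MDifferentiableOn 𝓘(ℝ, ℝ) 𝓘(ℝ, E) γ s)
    (hp : ∀ t ∈ s, γ t ∈ (trivializationAt E (TangentSpace 𝓘(ℝ, E)) p₀).baseSet) {w : ℝ → E}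
    (hw : ∀ t ∈ s, HasDerivWithinAt w (-christoffel E p₀ (γ t) (w t)
      (trivializationAt E (TangentSpace 𝓘(ℝ, E)) p₀ (velocityWithin E γ s t)).2) s t) :
    IsParallelAlong γ
      (fun t => ⟨γ t, (trivializationAt E (TangentSpace 𝓘(ℝ, E)) p₀).symmL ℝ (γ t) (w t)⟩) s := by
  have hV : MDifferentiableOn 𝓘(ℝ, ℝ) 𝓘(ℝ, E).tangent (fun t => (⟨γ t,
      (trivializationAt E (TangentSpace 𝓘(ℝ, E)) p₀).symmL ℝ (γ t) (w t)⟩ :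
        TangentBundle 𝓘(ℝ, E) M)) s := by
    intro t ht
    refine (Trivialization.mdifferentiableWithinAt_totalSpace_iff 𝓘(ℝ, E)
      (trivializationAt E (TangentSpace 𝓘(ℝ, E)) p₀) _
      ((trivializationAt E (TangentSpace 𝓘(ℝ, E)) p₀).mem_source.2 (hp t ht))).2
        ⟨hγ t ht, ?_⟩
    refine (hw t ht).differentiableWithinAt.mdifferentiableWithinAt.congr
      (fun τ hτ => trivializationAt_symmL_snd (hp τ hτ) _)
      (trivializationAt_symmL_snd (hp t ht) _)
  refine ⟨fun _ _ => rfl, hV, fun t ht => ?_⟩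
  refine (covDerivAlong_eq_zero_iff (fun _ _ => rfl) ht (hV t ht) (hs t ht) (hp t ht)).2 ?_
  rw [trivializationAt_symmL_snd (hp t ht)]
  exact (hw t ht).congr (fun τ hτ => trivializationAt_symmL_snd (hp τ hτ) _)
      (trivializationAt_symmL_snd (hp t ht) _)

end ParallelInChart

/-- A function that is smooth on an open set agrees near each point with a globally smooth one. -/
theorem ContDiffOn.exists_contDiff_eqOn_ball {E F : Type*} [NormedAddCommGroup E] [NormedSpace ℝ E]
    [FiniteDimensional ℝ E] [NormedAddCommGroup F] [NormedSpace ℝ F] {f : E → F} {U : Set E}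
    (hf : ContDiffOn ℝ ∞ f U) (hU : IsOpen U) {x : E} (hx : x ∈ U) :
    ∃ g : E → F, ContDiff ℝ ∞ g ∧ ∃ r > 0, Metric.ball x r ⊆ U ∧ EqOn g f (Metric.ball x r) := by
  obtain ⟨R, hR, hRt⟩ := Metric.nhds_basis_closedBall.mem_iff.1 (hU.mem_nhds hx)
  let χ : ContDiffBump x := ⟨R / 2, R, half_pos hR, half_lt_self hR⟩
  refine ⟨fun z => χ z • f z, ?_, R / 2, half_pos hR,
    (Metric.ball_subset_closedBall.trans (Metric.closedBall_subset_closedBall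
      (half_le_self hR.le))).trans hRt, fun z hz => ?_⟩
  · refine contDiff_iff_contDiffAt.2 fun z => ?_
    by_cases hz : z ∈ U
    · exact χ.contDiffAt.smul (hf.contDiffAt (hU.mem_nhds hz))
    · have hz' : z ∉ tsupport χ := by
        rw [χ.tsupport_eq]
        exact fun h => hz (hRt h)
      refine (contDiffAt_const (c := 0)).congr_of_eventuallyEq ?_
      filter_upwards [notMem_tsupport_iff_eventuallyEq.1 hz'] with y hy
      rw [hy, Pi.zero_apply, zero_smul]
  · change χ z • f z = f z
    rw [χ.one_of_mem_closedBall (Metric.ball_subset_closedBall hz), one_smul]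

/-! ### Uniqueness: geodesics against solutions of the spray equation. -/

section GeodesicsInChart

variable {E : Type*} [NormedAddCommGroup E] [NormedSpace ℝ E] [FiniteDimensional ℝ E]
  {M : Type*} [TopologicalSpace M] [ChartedSpace E M] [IsManifold 𝓘(ℝ, E) ∞ M]
  [RiemannianBundle (fun x : M => TangentSpace 𝓘(ℝ, E) x)]
  [IsContMDiffRiemannianBundle 𝓘(ℝ, E) ∞ E (fun x : M => TangentSpace 𝓘(ℝ, E) x)]

/-- The Christoffel symbols near a point extend to a globally smooth function on the model
space. -/
theorem exists_contDiff_eq_christoffel (p₀ : M) :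
    ∃ Γ : E → E →L[ℝ] E →L[ℝ] E, ContDiff ℝ ∞ Γ ∧ ∃ r > 0,
      Metric.ball (extChartAt 𝓘(ℝ, E) p₀ p₀) r ⊆ (extChartAt 𝓘(ℝ, E) p₀).target ∧
      ∀ z ∈ Metric.ball (extChartAt 𝓘(ℝ, E) p₀ p₀) r,
        Γ z = christoffel E p₀ ((extChartAt 𝓘(ℝ, E) p₀).symm z) := by
  obtain ⟨Γ, hΓ, r, hr, hrt, h⟩ := (contDiffOn_christoffel (E := E) p₀).exists_contDiff_eqOn_ball
    (isOpen_extChartAt_target p₀) (mem_extChartAt_target p₀)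
  exact ⟨Γ, hΓ, r, hr, hrt, h⟩

variable [T2Space M]

/-- `expMap` uses an unspecified geodesic, which is not known in advance to stay in the chart. The
times of agreement with the chart solution form a closed set that can always be prolonged to the
right by uniqueness for the spray equation, hence all of `[0,1]`. -/
theorem IsGeodesic.eq_of_chart_solution {γ : ℝ → M} (hγ : IsGeodesic E γ) {p₀ : M}
    (hγ0 : γ 0 = p₀) {Γ : E → E →L[ℝ] E →L[ℝ] E} (hΓ : ContDiff ℝ ∞ Γ) {r : ℝ}
    (hr : Metric.ball (extChartAt 𝓘(ℝ, E) p₀ p₀) r ⊆ (extChartAt 𝓘(ℝ, E) p₀).target)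
    (hΓr : ∀ z ∈ Metric.ball (extChartAt 𝓘(ℝ, E) p₀ p₀) r,
        Γ z = christoffel E p₀ ((extChartAt 𝓘(ℝ, E) p₀).symm z))
    {ζ : ℝ → E × E} (hζ0 : ζ 0 = (extChartAt 𝓘(ℝ, E) p₀ p₀,
      (trivializationAt E (TangentSpace 𝓘(ℝ, E)) p₀ (velocityWithin E γ univ 0)).2))
    (hζ : ∀ t ∈ Icc (0 : ℝ) 1, HasDerivWithinAt ζ (geodesicSpray Γ (ζ t)) (Icc 0 1) t)
    (hζr : ∀ t ∈ Icc (0 : ℝ) 1, (ζ t).1 ∈ Metric.ball (extChartAt 𝓘(ℝ, E) p₀ p₀) r) :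
    ∀ t ∈ Icc (0 : ℝ) 1, γ t = (extChartAt 𝓘(ℝ, E) p₀).symm (ζ t).1 := by
  set φ := extChartAt 𝓘(ℝ, E) p₀ with hφ
  set e₀ := trivializationAt E (TangentSpace 𝓘(ℝ, E)) p₀ with he₀
  have hbase : e₀.baseSet = φ.source := by
    rw [he₀, TangentBundle.trivializationAt_baseSet, hφ, extChartAt_source]
  have hγc : Continuous γ := hγ.1.continuous
  have hζc : ContinuousOn ζ (Icc 0 1) := fun t ht => (hζ t ht).continuousWithinAt
  set V : ℝ → E := fun t => (e₀ (velocityWithin E γ univ t)).2 with hV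
  have hVd : ∀ t, γ t ∈ φ.source → HasDerivAt V (-christoffel E p₀ (γ t) (V t) (V t)) t := by
    intro t ht
    rw [← hbase] at ht
    exact (hγ.2.hasDerivWithinAt (mem_univ t) uniqueDiffWithinAt_univ ht).hasDerivAt univ_mem
  have hxd : ∀ t, γ t ∈ φ.source → HasDerivAt (fun τ => φ (γ τ)) (V t) t := by
    intro t ht
    rw [← hbase] at ht
    exact (hasDerivWithinAt_extChartAt_comp (hγ.1 t).mdifferentiableWithinAt ht).hasDerivAt
      univ_mem
  have hφs : ContinuousOn (fun t => φ.symm (ζ t).1) (Icc 0 1) :=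
    (continuousOn_extChartAt_symm p₀).comp (continuous_fst.comp_continuousOn hζc)
      fun t ht => hr (hζr t ht)
  -- Velocities are included because the equation is of second order.
  set S : Set ℝ := {t | γ t = φ.symm (ζ t).1 ∧ V t = (ζ t).2} with hS
  suffices Icc (0 : ℝ) 1 ⊆ S from fun t ht => (this ht).1
  refine IsClosed.Icc_subset_of_forall_mem_nhdsWithin ?_ ?_ ?_
  -- Closedness in two stages: continuity of `V` is available only where `γ` is in the chart, which
  -- agreement of the positions ensures.
  · have h1 : IsClosed (Icc (0 : ℝ) 1 ∩ (fun t => (γ t, φ.symm (ζ t).1)) ⁻¹' diagonal M) :=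
      (hγc.continuousOn.prodMk hφs).preimage_isClosed_of_isClosed isClosed_Icc isClosed_diagonal
    have h2 : ContinuousOn V (Icc (0 : ℝ) 1 ∩ (fun t => (γ t, φ.symm (ζ t).1)) ⁻¹' diagonal M) := by
      rintro t ⟨ht, htd⟩
      refine (hVd t ?_).continuousAt.continuousWithinAt
      rw [show γ t = φ.symm (ζ t).1 from htd]
      exact φ.map_target (hr (hζr t ht))
    have h3 := (h2.prodMk (continuous_snd.comp_continuousOn
      (hζc.mono inter_subset_left))).preimage_isClosed_of_isClosed h1 (isClosed_diagonal (X := E))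
    convert h3 using 1
    ext t
    simp only [hS, mem_inter_iff, mem_ofPred_eq, mem_preimage, mem_diagonal_iff]
    tauto
  · refine ⟨?_, ?_⟩
    · rw [hγ0, hζ0]
      exact (extChartAt_to_inv p₀).symm
    · rw [hζ0]
  · rintro t ⟨⟨ht1, ht2⟩, ht⟩
    have htI : t ∈ Icc (0 : ℝ) 1 := Ico_subset_Icc_self ht
    have hts : γ t ∈ φ.source := by
      rw [ht1]
      exact φ.map_target (hr (hζr t htI))
    have hφt : φ (γ t) = (ζ t).1 := by
      rw [ht1]
      exact φ.right_inv (hr (hζr t htI))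
    set y : ℝ → E × E := fun τ => (φ (γ τ), V τ) with hy
    have hyt : y t = ζ t := Prod.ext hφt ht2
    have hyc : ContinuousAt y t :=
      (hxd t hts).continuousAt.prodMk (hVd t hts).continuousAt
    obtain ⟨K, s, hs, hK⟩ := ((contDiff_geodesicSpray hΓ).contDiffAt (x := ζ t)).of_le
      (m := 1) (by simp) |>.exists_lipschitzOnWith
    have hs1 : ∀ᶠ τ in 𝓝[≥] t, y τ ∈ s ∧ γ τ ∈ φ.source ∧ φ (γ τ) ∈ Metric.ball (φ p₀) r := by
      have a1 : ∀ᶠ τ in 𝓝 t, y τ ∈ s := hyc (by rw [hyt]; exact hs)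
      have a2 : ∀ᶠ τ in 𝓝 t, γ τ ∈ φ.source :=
        hγc.continuousAt ((isOpen_extChartAt_source p₀).mem_nhds hts)
      have a3 : ∀ᶠ τ in 𝓝 t, φ (γ τ) ∈ Metric.ball (φ p₀) r :=
        (hxd t hts).continuousAt (Metric.isOpen_ball.mem_nhds (by
          simp only [hφt]; exact hζr t htI))
      exact (a1.and (a2.and a3)).filter_mono nhdsWithin_le_nhds
    have hs2 : ∀ᶠ τ in 𝓝[≥] t, ζ τ ∈ s ∧ τ ∈ Ico (0 : ℝ) 1 := by
      have b1 : ∀ᶠ τ in 𝓝[≥] t, τ ∈ Ico t 1 := Ico_mem_nhdsGE ht.2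
      have b2 : ∀ᶠ τ in 𝓝[Icc 0 1] t, ζ τ ∈ s := hζc t htI hs
      have b3 : 𝓝[≥] t ≤ 𝓝[Icc (0 : ℝ) 1] t :=
        nhdsWithin_le_of_mem (mem_of_superset (Icc_mem_nhdsGE ht.2)
          (Icc_subset_Icc ht.1 le_rfl))
      exact (b2.filter_mono b3).and (b1.mono fun τ hτ => ⟨ht.1.trans hτ.1, hτ.2⟩)
    obtain ⟨b, hb, hbs⟩ := mem_nhdsGE_iff_exists_Icc_subset.1 (hs1.and hs2)
    have hEq : EqOn y ζ (Icc t b) := by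
      refine ODE_solution_unique_of_mem_Icc_right (v := fun _ => geodesicSpray Γ) (K := K)
        (s := fun _ => s) (fun _ _ => hK) ?_ ?_ (fun τ hτ => (hbs (Ico_subset_Icc_self hτ)).1.1)
        (hζc.mono fun τ hτ => Ico_subset_Icc_self (hbs hτ).2.2) ?_
        (fun τ hτ => (hbs (Ico_subset_Icc_self hτ)).2.1) hyt
      · intro τ hτ
        have h1 := (hbs hτ).1.2.1
        exact ((hxd τ h1).continuousAt.prodMk (hVd τ h1).continuousAt).continuousWithinAt
      · intro τ hτ
        obtain ⟨h1, h2⟩ := (hbs (Ico_subset_Icc_self hτ)).1.2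
        have h3 := (hxd τ h1).prodMk (hVd τ h1)
        have h4 : geodesicSpray Γ (y τ) = (V τ, -christoffel E p₀ (γ τ) (V τ) (V τ)) := by
          simp only [geodesicSpray, hy]
          rw [hΓr _ h2, φ.left_inv h1]
        rw [h4]
        exact h3.hasDerivWithinAt
      · intro τ hτ
        have h1 := (hbs (Ico_subset_Icc_self hτ)).2.2
        refine (hζ τ (Ico_subset_Icc_self h1)).mono_of_mem_nhdsWithin ?_
        exact mem_of_superset (Icc_mem_nhdsGE h1.2) (Icc_subset_Icc h1.1 le_rfl)
    refine mem_of_superset (Icc_mem_nhdsGT hb) fun τ hτ => ?_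
    have h1 := hEq hτ
    refine ⟨?_, congrArg Prod.snd h1⟩
    rw [← congrArg Prod.fst h1]
    exact (φ.left_inv (hbs hτ).1.2.1).symm

end GeodesicsInChart

/-- The inverse function theorem at a point with derivative the identity, with smoothness of the
inverse on a whole neighbourhood. -/
theorem ContDiffOn.exists_openPartialHomeomorph {E : Type*} [NormedAddCommGroup E] [NormedSpace ℝ E]
    [CompleteSpace E] {f : E → E} {U : Set E} (hf : ContDiffOn ℝ ∞ f U) (hU : IsOpen U) {x : E}
    (hx : x ∈ U) (hd : HasFDerivAt f (ContinuousLinearMap.id ℝ E) x) :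
    ∃ Ψ : OpenPartialHomeomorph E E, x ∈ Ψ.source ∧ Ψ.source ⊆ U ∧ (∀ v, Ψ v = f v) ∧
      ContDiffOn ℝ ∞ Ψ Ψ.source ∧ ContDiffOn ℝ ∞ Ψ.symm Ψ.target := by
  have hfx : ContDiffAt ℝ ∞ f x := hf.contDiffAt (hU.mem_nhds hx)
  set e := hfx.toOpenPartialHomeomorph f
    (f' := ContinuousLinearEquiv.refl ℝ E) hd (by simp) with he
  have hex : x ∈ e.source := hfx.mem_toOpenPartialHomeomorph_source _ _
  have hc : ContinuousOn (fderiv ℝ f) U := hf.continuousOn_fderiv_of_isOpen hU (by simp)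
  set S := U ∩ fderiv ℝ f ⁻¹' (range ((↑) : (E ≃L[ℝ] E) → E →L[ℝ] E)) with hS
  have hSo : IsOpen S := hc.isOpen_inter_preimage hU ContinuousLinearEquiv.isOpen
  have hxS : x ∈ S := ⟨hx, ContinuousLinearEquiv.refl ℝ E, hd.fderiv.symm⟩
  have hsrc : (e.restrOpen S hSo).source ⊆ S := by
    rw [OpenPartialHomeomorph.restrOpen_source]
    exact inter_subset_right
  refine ⟨e.restrOpen S hSo, ?_, hsrc.trans inter_subset_left, fun v => rfl, ?_, ?_⟩
  · rw [OpenPartialHomeomorph.restrOpen_source]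
    exact ⟨hex, hxS⟩
  · exact hf.mono (hsrc.trans inter_subset_left)
  · intro w hw
    obtain ⟨h1, D, hD⟩ := hsrc ((e.restrOpen S hSo).map_target hw)
    have h2 := hf.contDiffAt (hU.mem_nhds h1)
    refine ((e.restrOpen S hSo).contDiffAt_symm hw (f₀' := D) ?_ h2).contDiffWithinAt
    rw [hD]
    exact (h2.differentiableAt (by simp)).hasFDerivAt

/-! ### The exponential map near the origin and the injectivity radius. -/

section Exponential

variable {E : Type*} [NormedAddCommGroup E] [NormedSpace ℝ E] [FiniteDimensional ℝ E]
  {M : Type*} [TopologicalSpace M] [ChartedSpace E M] [IsManifold 𝓘(ℝ, E) ∞ M]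

/-- The components of tangent vectors at `p₀` in the chart at `p₀`. -/
noncomputable def tangentCoords (E : Type*) [NormedAddCommGroup E] [NormedSpace ℝ E]
    {M : Type*} [TopologicalSpace M] [ChartedSpace E M] [IsManifold 𝓘(ℝ, E) ∞ M] (p₀ : M) :
    TangentSpace 𝓘(ℝ, E) p₀ ≃L[ℝ] E :=
  (trivializationAt E (TangentSpace 𝓘(ℝ, E)) p₀).continuousLinearEquivAt ℝ p₀
    (FiberBundle.mem_baseSet_trivializationAt' p₀)

theorem tangentCoords_apply (p₀ : M) (ξ : TangentSpace 𝓘(ℝ, E) p₀) :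
    tangentCoords E p₀ ξ = (trivializationAt E (TangentSpace 𝓘(ℝ, E)) p₀ ⟨p₀, ξ⟩).2 := rfl

variable [RiemannianBundle (fun x : M => TangentSpace 𝓘(ℝ, E) x)]
  [IsContMDiffRiemannianBundle 𝓘(ℝ, E) ∞ E (fun x : M => TangentSpace 𝓘(ℝ, E) x)]
  [T2Space M]

/-- The exponential map is a local diffeomorphism in charts. -/
theorem exists_expMap_eq (hM : IsGeodesicallyComplete E M) (p₀ : M) :
    ∃ Ψ : OpenPartialHomeomorph E E, (0 : E) ∈ Ψ.source ∧ Ψ 0 = extChartAt 𝓘(ℝ, E) p₀ p₀ ∧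
      Ψ.target ⊆ (chartAt E p₀).target ∧
      ContDiffOn ℝ ∞ Ψ Ψ.source ∧ ContDiffOn ℝ ∞ Ψ.symm Ψ.target ∧
      ∀ ξ : TangentSpace 𝓘(ℝ, E) p₀, tangentCoords E p₀ ξ ∈ Ψ.source →
        expMap p₀ ξ = (chartAt E p₀).symm (Ψ (tangentCoords E p₀ ξ)) := by
  obtain ⟨Γ, hΓ, r, hr, hrt, hΓr⟩ := exists_contDiff_eq_christoffel (E := E) p₀
  -- `W` keeps the solutions, up to time one, in the ball where the globally smooth `Γ` equals the
  -- true Christoffel symbols.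
  obtain ⟨U, ζ, hU, h0U, hζ, hψ, hψd, hψ0⟩ := exists_smooth_geodesic_flow hΓ
    (extChartAt 𝓘(ℝ, E) p₀ p₀) (W := Prod.fst ⁻¹' Metric.ball (extChartAt 𝓘(ℝ, E) p₀ p₀) r)
    (continuous_fst.continuousAt (Metric.ball_mem_nhds _ hr))
  obtain ⟨Ψ, hΨ0, hΨU, hΨ, hΨs, hΨs'⟩ := hψ.exists_openPartialHomeomorph hU h0U hψd
  have htgt : (extChartAt 𝓘(ℝ, E) p₀).target = (chartAt E p₀).target := by simp [mfld_simps]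
  refine ⟨Ψ, hΨ0, (hΨ 0).trans hψ0, fun y hy => ?_, hΨs, hΨs', fun ξ hξ => ?_⟩
  · have h1 := Ψ.map_target hy
    rw [← Ψ.right_inv hy, hΨ, ← htgt]
    exact hrt ((hζ _ (hΨU h1)).2 1 (by simp)).1
  -- Completeness excludes the default value of `expMap`; uniqueness then evaluates the chosen
  -- geodesic.
  · have hex : ∃ γ : ℝ → M, IsGeodesic E γ ∧
        velocityWithin E γ univ 0 = (⟨p₀, ξ⟩ : TangentBundle 𝓘(ℝ, E) M) := hM ⟨p₀, ξ⟩
    rw [expMap, dif_pos hex]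
    obtain ⟨h1, h2⟩ := hex.choose_spec
    obtain ⟨h3, h4⟩ := hζ _ (hΨU hξ)
    have h5 : hex.choose 0 = p₀ := congrArg TotalSpace.proj h2
    rw [hΨ]
    have := h1.eq_of_chart_solution h5 hΓ hrt hΓr (ζ := ζ (tangentCoords E p₀ ξ))
      (by rw [h3, h2, tangentCoords_apply]) (fun t ht => (h4 t ht).2) (fun t ht => (h4 t ht).1) 1
      (by simp)
    rw [this]
    simp [mfld_simps]

/-- Coordinates on the tangent space, then `Ψ`, then the inverse chart, restricted to the Riemannian
ball, form the diffeomorphism required of a competitor in the supremum. -/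
theorem le_injectivityRadius {p₀ : M} {Ψ : OpenPartialHomeomorph E E}
    (hΨt : Ψ.target ⊆ (chartAt E p₀).target)
    (hΨ : ContDiffOn ℝ ∞ Ψ Ψ.source) (hΨ' : ContDiffOn ℝ ∞ Ψ.symm Ψ.target)
    (hexp : ∀ ξ : TangentSpace 𝓘(ℝ, E) p₀, tangentCoords E p₀ ξ ∈ Ψ.source →
        expMap p₀ ξ = (chartAt E p₀).symm (Ψ (tangentCoords E p₀ ξ)))
    {r : ℝ} (hr : 0 < r)
    (hrΨ : ∀ ξ ∈ Metric.ball (0 : TangentSpace 𝓘(ℝ, E) p₀) r, tangentCoords E p₀ ξ ∈ Ψ.source) :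
    ENNReal.ofReal r ≤ injectivityRadius E p₀ := by
  let A : OpenPartialHomeomorph (TangentSpace 𝓘(ℝ, E) p₀) M :=
    ((tangentCoords E p₀).toHomeomorph.toOpenPartialHomeomorph.trans
      (Ψ.trans (chartAt E p₀).symm)).restrOpen
      (Metric.ball (0 : TangentSpace 𝓘(ℝ, E) p₀) r) Metric.isOpen_ball
  have hAs : A.source = Metric.ball (0 : TangentSpace 𝓘(ℝ, E) p₀) r := by
    refine inter_eq_right.2 fun ξ hξ => ?_
    exact ⟨mem_univ _, hrΨ ξ hξ, hΨt (Ψ.map_source (hrΨ ξ hξ))⟩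
  have hAt : A.target ⊆ (chartAt E p₀).source ∩ chartAt E p₀ ⁻¹' Ψ.target := by
    intro p hp
    have h1 : A.symm p ∈ Metric.ball (0 : TangentSpace 𝓘(ℝ, E) p₀) r := hAs ▸ A.map_target hp
    have h2 : p = (chartAt E p₀).symm (Ψ (tangentCoords E p₀ (A.symm p))) := (A.right_inv hp).symm
    have h3 := Ψ.map_source (hrΨ _ h1)
    rw [h2]
    refine ⟨(chartAt E p₀).map_target (hΨt h3), ?_⟩
    rwa [mem_preimage, (chartAt E p₀).right_inv (hΨt h3)]
  refine le_sSup ⟨r, hr, rfl, ⟨A.toPartialEquiv, A.open_source, A.open_target, ?_, ?_⟩, hAs, ?_⟩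
  · change ContMDiffOn _ _ _ ((chartAt E p₀).symm ∘ (Ψ ∘ tangentCoords E p₀)) A.source
    rw [hAs]
    refine (contMDiffOn_chart_symm (I := 𝓘(ℝ, E)) (n := ∞) (x := p₀)).comp (t := (chartAt E p₀).target)
      ?_ fun ξ hξ => hΨt (Ψ.map_source (hrΨ ξ hξ))
    exact (hΨ.comp (tangentCoords E p₀).contDiff.contDiffOn hrΨ).contMDiffOn
  · change ContMDiffOn _ _ _ (((tangentCoords E p₀).symm ∘ Ψ.symm) ∘ chartAt E p₀) A.target
    refine ContMDiffOn.comp (t := Ψ.target) ?_ ((contMDiffOn_chart (I := 𝓘(ℝ, E)) (n := ∞)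
      (x := p₀)).mono fun p hp => (hAt hp).1) fun p hp => (hAt hp).2
    exact ((tangentCoords E p₀).symm.contDiff.comp_contDiffOn hΨ').contMDiffOn
  · intro ξ hξ
    exact hexp ξ (hrΨ ξ hξ)

/-- The preimage chosen by `expInv` and `ξ` both have norm below a supremum, hence below one radius
`r` for which `exp` is injective on the ball. -/
theorem expInv_expMap {p₀ : M} {ξ : TangentSpace 𝓘(ℝ, E) p₀}
    (hξ : ‖ξ‖ₑ < injectivityRadius E p₀) : expInv E p₀ (expMap p₀ ξ) = ξ := by
  have hex : ∃ v : TangentSpace 𝓘(ℝ, E) p₀, ‖v‖ₑ < injectivityRadius E p₀ ∧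
      expMap p₀ v = expMap p₀ ξ := ⟨ξ, hξ, rfl⟩
  rw [expInv, dif_pos hex]
  obtain ⟨h1, h2⟩ := hex.choose_spec
  set v := hex.choose
  obtain ⟨-, ⟨r, hr, rfl, Φ, hΦs, hΦ⟩, hlt⟩ := lt_sSup_iff.1 (max_lt h1 hξ)
  have hmem : ∀ η : TangentSpace 𝓘(ℝ, E) p₀, ‖η‖ₑ < ENNReal.ofReal r →
      η ∈ Metric.ball (0 : TangentSpace 𝓘(ℝ, E) p₀) r := by
    intro η hη
    rw [← ofReal_norm, ENNReal.ofReal_lt_ofReal_iff hr] at hη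
    simpa using hη
  have hv := hmem v ((le_max_left _ _).trans_lt hlt)
  have hx := hmem ξ ((le_max_right _ _).trans_lt hlt)
  refine Φ.toPartialEquiv.injOn (hΦs ▸ hv) (hΦs ▸ hx) ?_
  exact (hΦ hv).symm.trans (h2.trans (hΦ hx))

end Exponential

section Exponential

variable {E : Type*} [NormedAddCommGroup E] [NormedSpace ℝ E] [FiniteDimensional ℝ E]
  {M : Type*} [TopologicalSpace M] [ChartedSpace E M] [IsManifold 𝓘(ℝ, E) ∞ M]
  [RiemannianBundle (fun x : M => TangentSpace 𝓘(ℝ, E) x)]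
  [IsContMDiffRiemannianBundle 𝓘(ℝ, E) ∞ E (fun x : M => TangentSpace 𝓘(ℝ, E) x)]
  [T2Space M]

/-- Near a point, the injectivity radius is positive and the geodesic segments from that point are
given in the chart by a local diffeomorphism. -/
theorem exists_normalGeodesic_eq (hM : IsGeodesicallyComplete E M) (p₀ : M) :
    0 < injectivityRadius E p₀ ∧
    ∃ Ψ : OpenPartialHomeomorph E E, (0 : E) ∈ Ψ.source ∧ Ψ.target ⊆ (chartAt E p₀).target ∧
      ContDiffOn ℝ ∞ Ψ Ψ.source ∧
      ∃ g : M → E, Tendsto g (𝓝 p₀) (𝓝 0) ∧ ∀ᶠ p in 𝓝 p₀,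
        normalGeodesic E p₀ p 0 = p₀ ∧ normalGeodesic E p₀ p 1 = p ∧
        ∀ t ∈ Icc (0 : ℝ) 1, t • g p ∈ Ψ.source ∧
          normalGeodesic E p₀ p t = (chartAt E p₀).symm (Ψ (t • g p)) := by
  obtain ⟨Ψ, h0, hΨ0, hΨt, hΨ, hΨ', hexp⟩ := exists_expMap_eq (E := E) hM p₀
  have hΨ0' : Ψ 0 = chartAt E p₀ p₀ := by simpa [mfld_simps] using hΨ0
  -- Two norms are in play: `ρ` is a radius for the norm of `E`, and `r` below one for the
  -- Riemannian norm, in which the injectivity radius is measured.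
  obtain ⟨ρ, hρ, hρs⟩ := Metric.mem_nhds_iff.1 (Ψ.open_source.mem_nhds h0)
  obtain ⟨r, hr, hrρ⟩ := Metric.mem_nhds_iff.1
    ((tangentCoords E p₀).continuous.continuousAt (x := 0) (by
      rw [map_zero]; exact Metric.ball_mem_nhds _ hρ) :
      tangentCoords E p₀ ⁻¹' Metric.ball 0 ρ ∈ 𝓝 (0 : TangentSpace 𝓘(ℝ, E) p₀))
  have hinj : ENNReal.ofReal r ≤ injectivityRadius E p₀ :=
    le_injectivityRadius hΨt hΨ hΨ' hexp hr fun ξ hξ => hρs (hrρ hξ)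
  have hg : Tendsto (fun p => Ψ.symm (chartAt E p₀ p)) (𝓝 p₀) (𝓝 0) := by
    have h1 : ContinuousAt (chartAt E p₀) p₀ :=
      (chartAt E p₀).continuousAt (mem_chart_source E p₀)
    have h2 := Ψ.tendsto_symm h0
    rw [hΨ0'] at h2
    exact h2.comp h1
  have hgξ : Tendsto (fun p => (tangentCoords E p₀).symm (Ψ.symm (chartAt E p₀ p))) (𝓝 p₀)
      (𝓝 0) := by
    have := ((tangentCoords E p₀).symm.continuous.tendsto 0).comp hg
    rwa [map_zero] at this
  refine ⟨(ENNReal.ofReal_pos.2 hr).trans_le hinj, Ψ, h0, hΨt, hΨ, _, hg, ?_⟩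
  have hT : Ψ.target ∈ 𝓝 (chartAt E p₀ p₀) := by
    rw [← hΨ0']
    exact Ψ.open_target.mem_nhds (Ψ.map_source h0)
  filter_upwards [hgξ (Metric.ball_mem_nhds _ hr),
    (chartAt E p₀).continuousAt (mem_chart_source E p₀) hT,
    (chartAt E p₀).open_source.mem_nhds (mem_chart_source E p₀)] with p hp1 hp2 hp3
  set ξ : TangentSpace 𝓘(ℝ, E) p₀ := (tangentCoords E p₀).symm (Ψ.symm (chartAt E p₀ p)) with hξ
  have hξg : tangentCoords E p₀ ξ = Ψ.symm (chartAt E p₀ p) := by simp [hξ]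
  have hξρ : tangentCoords E p₀ ξ ∈ Metric.ball (0 : E) ρ := hrρ hp1
  have hseg : ∀ t ∈ Icc (0 : ℝ) 1, t • tangentCoords E p₀ ξ ∈ Ψ.source := by
    intro t ht
    refine hρs ?_
    rw [mem_ball_zero_iff] at hξρ ⊢
    rw [norm_smul, Real.norm_of_nonneg ht.1]
    exact (mul_le_of_le_one_left (norm_nonneg _) ht.2).trans_lt hξρ
  have hpξ : expMap p₀ ξ = p := by
    rw [hexp _ (hρs hξρ), hξg, Ψ.right_inv hp2, (chartAt E p₀).left_inv hp3]
  have hlt : ‖ξ‖ₑ < injectivityRadius E p₀ := by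
    refine lt_of_lt_of_le ?_ hinj
    rw [← ofReal_norm, ENNReal.ofReal_lt_ofReal_iff hr]
    simpa using hp1
  have hinv : expInv E p₀ p = ξ := by
    conv_lhs => rw [← hpξ]
    exact expInv_expMap hlt
  have hng : ∀ t ∈ Icc (0 : ℝ) 1, normalGeodesic E p₀ p t =
      (chartAt E p₀).symm (Ψ (t • tangentCoords E p₀ ξ)) := by
    intro t ht
    rw [normalGeodesic, hinv, hexp, map_smul]
    rw [map_smul]
    exact hseg t ht
  refine ⟨?_, ?_, ?_⟩
  · rw [hng 0 (by simp), zero_smul, hΨ0', (chartAt E p₀).left_inv (mem_chart_source E p₀)]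
  · rw [normalGeodesic, hinv, one_smul, hpξ]
  · rw [← hξg]
    exact fun t ht => ⟨hseg t ht, hng t ht⟩

end Exponential

/-! ### Linear equations with small coefficients on `[0,1]`. -/

section LinearODE

variable {F : Type*} [NormedAddCommGroup F] [NormedSpace ℝ F]

/-- At a maximum `m` of the norm, `‖w t - w a‖ ≤ K ‖w m‖` for all `t`; as `K ≤ 1/2`, taking `t = m`
gives `‖w m‖ ≤ 2 ‖w a‖`. The initial time `a` may be either end, which covers both directions of
transport. -/
theorem norm_sub_le_of_hasDerivWithinAt_linear {w : ℝ → F} {G : ℝ → F →L[ℝ] F} {K : ℝ}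
    (hw : ∀ t ∈ Icc (0 : ℝ) 1, HasDerivWithinAt w (-G t (w t)) (Icc 0 1) t)
    (hG : ∀ t ∈ Icc (0 : ℝ) 1, ‖G t‖ ≤ K) (hK : K ≤ 1 / 2) {a b : ℝ} (ha : a ∈ Icc (0 : ℝ) 1)
    (hb : b ∈ Icc (0 : ℝ) 1) : ‖w b - w a‖ ≤ 2 * K * ‖w a‖ := by
  have hK0 : 0 ≤ K := (norm_nonneg _).trans (hG a ha)
  have hc : ContinuousOn w (Icc 0 1) := fun t ht => (hw t ht).continuousWithinAt
  obtain ⟨m, hm, hmax⟩ := isCompact_Icc.exists_isMaxOn ⟨a, ha⟩ hc.norm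
  have hmv : ∀ t ∈ Icc (0 : ℝ) 1, ‖w t - w a‖ ≤ K * ‖w m‖ := by
    intro t ht
    have h1 := (convex_Icc (0 : ℝ) 1).norm_image_sub_le_of_norm_hasDerivWithin_le hw
      (C := K * ‖w m‖) (fun s hs => by
        rw [norm_neg]
        exact ((G s).le_opNorm _).trans (mul_le_mul (hG s hs) (hmax hs) (norm_nonneg _) hK0)) ha ht
    refine h1.trans (mul_le_of_le_one_right (by positivity) ?_)
    rw [Real.norm_eq_abs, abs_le]
    constructor <;> linarith [ha.1, ha.2, ht.1, ht.2]
  have h2 : ‖w m‖ ≤ 2 * ‖w a‖ := by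
    have h3 := hmv m hm
    have h4 : ‖w m‖ ≤ ‖w m - w a‖ + ‖w a‖ := by simpa using norm_add_le (w m - w a) (w a)
    nlinarith [norm_nonneg (w m)]
  calc ‖w b - w a‖ ≤ K * ‖w m‖ := hmv b hb
    _ ≤ K * (2 * ‖w a‖) := by gcongr
    _ = 2 * K * ‖w a‖ := by ring

/-- Solving for operators makes the solution linear in the initial value. In the unit ball about the
identity `‖A‖ ≤ 2`, so the right side has norm at most `1` and Picard–Lindelöf reaches the whole
unit interval. -/
theorem exists_hasDerivWithinAt_linear [CompleteSpace F] {G : ℝ → F →L[ℝ] F}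
    (hGc : ContinuousOn G (Icc 0 1)) (hG : ∀ t ∈ Icc (0 : ℝ) 1, ‖G t‖ ≤ 1 / 2) {a : ℝ}
    (ha : a ∈ Icc (0 : ℝ) 1) :
    ∃ A : ℝ → F →L[ℝ] F, A a = ContinuousLinearMap.id ℝ F ∧
      ∀ t ∈ Icc (0 : ℝ) 1, HasDerivWithinAt A (-(G t ∘L A t)) (Icc 0 1) t := by
  have hPL : IsPicardLindelof (fun t (A : F →L[ℝ] F) => -(G t ∘L A)) (tmin := 0) (tmax := 1)
      ⟨a, ha⟩ (ContinuousLinearMap.id ℝ F) 1 0 1 1 := by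
    refine ⟨?_, ?_, ?_, ?_⟩
    · intro t ht
      refine LipschitzWith.lipschitzOnWith (LipschitzWith.of_dist_le_mul fun A B => ?_)
      rw [dist_neg_neg, dist_eq_norm, dist_eq_norm, ← ContinuousLinearMap.comp_sub]
      refine (ContinuousLinearMap.opNorm_comp_le _ _).trans ?_
      refine mul_le_mul_of_nonneg_right ((hG t ht).trans ?_) (norm_nonneg _)
      norm_num
    · intro A _
      exact (hGc.clm_comp continuousOn_const).neg
    · intro t ht A hA
      rw [norm_neg]
      have h1 : ‖A‖ ≤ 2 := by
        rw [mem_closedBall_iff_norm] at hA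
        have h2 := norm_add_le (A - ContinuousLinearMap.id ℝ F) (ContinuousLinearMap.id ℝ F)
        have h3 : ‖ContinuousLinearMap.id ℝ F‖ ≤ 1 := ContinuousLinearMap.norm_id_le
        rw [sub_add_cancel] at h2
        have h4 : ((1 : NNReal) : ℝ) = 1 := rfl
        rw [h4] at hA
        linarith
      refine (ContinuousLinearMap.opNorm_comp_le _ _).trans ?_
      calc ‖G t‖ * ‖A‖ ≤ (1 / 2) * 2 := by
            gcongr
            exact hG t ht
        _ = ((1 : NNReal) : ℝ) := by norm_num
    · simp only [NNReal.coe_one, one_mul, NNReal.coe_zero, sub_zero]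
      exact max_le (by linarith [ha.1]) (by linarith [ha.2])
  exact hPL.exists_eq_forall_mem_Icc_hasDerivWithinAt₀

end LinearODE

/-! ### Parallel transport along short geodesics is close to the identity. -/

section ParallelTransport

variable {E : Type*} [NormedAddCommGroup E] [NormedSpace ℝ E] [FiniteDimensional ℝ E]
  {M : Type*} [TopologicalSpace M] [ChartedSpace E M] [IsManifold 𝓘(ℝ, E) ∞ M]
  [RiemannianBundle (fun x : M => TangentSpace 𝓘(ℝ, E) x)]
  [IsContMDiffRiemannianBundle 𝓘(ℝ, E) ∞ E (fun x : M => TangentSpace 𝓘(ℝ, E) x)]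

/-- Parallel transport along a curve in a chart whose connection coefficients are small is close to
the identity in the frame of the chart. -/
theorem norm_parallelTransport_sub_le {γ : ℝ → M} {p₀ : M}
    (hγ : MDifferentiableOn 𝓘(ℝ, ℝ) 𝓘(ℝ, E) γ (Icc 0 1))
    (hbase : ∀ t ∈ Icc (0 : ℝ) 1, γ t ∈ (trivializationAt E (TangentSpace 𝓘(ℝ, E)) p₀).baseSet)
    {G : ℝ → E →L[ℝ] E} (hGc : ContinuousOn G (Icc 0 1))
    (hGγ : ∀ t ∈ Icc (0 : ℝ) 1, ∀ w, christoffel E p₀ (γ t) w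
      (trivializationAt E (TangentSpace 𝓘(ℝ, E)) p₀ (velocityWithin E γ (Icc 0 1) t)).2 = G t w)
    {K : ℝ} (hG : ∀ t ∈ Icc (0 : ℝ) 1, ‖G t‖ ≤ K) (hK : K ≤ 1 / 2) {a b : ℝ}
    (hab : uIcc a b = Icc 0 1) {p q : M} (hp : γ a = p) (hq : γ b = q) (w : E) :
    ‖(trivializationAt E (TangentSpace 𝓘(ℝ, E)) p₀ ⟨q, parallelTransport E γ a b p q
      ((trivializationAt E (TangentSpace 𝓘(ℝ, E)) p₀).symmL ℝ p w)⟩).2 - w‖ ≤ 2 * K * ‖w‖ := by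
  set e₀ := trivializationAt E (TangentSpace 𝓘(ℝ, E)) p₀ with he₀
  have ha : a ∈ Icc (0 : ℝ) 1 := hab ▸ left_mem_uIcc
  have hb : b ∈ Icc (0 : ℝ) 1 := hab ▸ right_mem_uIcc
  have hs : UniqueDiffOn ℝ (Icc (0 : ℝ) 1) := uniqueDiffOn_Icc one_pos
  subst hp hq
  -- Existence shows that `parallelTransport` is not its default value `0`.
  have hex : ∃ P : TangentSpace 𝓘(ℝ, E) (γ a) →L[ℝ] TangentSpace 𝓘(ℝ, E) (γ b),
      IsParallelTransport γ a b (γ a) (γ b) P := by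
    obtain ⟨A, hAa, hA⟩ := exists_hasDerivWithinAt_linear hGc (fun t ht => (hG t ht).trans hK) ha
    refine ⟨e₀.symmL ℝ (γ b) ∘L A b ∘L e₀.continuousLinearMapAt ℝ (γ a), fun v =>
      ⟨fun t => ⟨γ t, e₀.symmL ℝ (γ t) (A t (e₀.continuousLinearMapAt ℝ (γ a) v))⟩, ?_, ?_, rfl⟩⟩
    · rw [hab]
      refine isParallelAlong_symmL (E := E) hs hγ hbase
        (w := fun t => A t (e₀.continuousLinearMapAt ℝ (γ a) v)) fun t ht => ?_
      rw [hGγ t ht]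
      simpa using (hA t ht).clm_apply
        (hasDerivWithinAt_const t (Icc 0 1) (e₀.continuousLinearMapAt ℝ (γ a) v))
    · beta_reduce
      rw [hAa, ContinuousLinearMap.id_apply, e₀.symmL_continuousLinearMapAt (hbase a ha)]
  rw [parallelTransport, dif_pos hex]
  -- The bound holds for every parallel field with this initial value, so it applies to whichever
  -- transport was chosen.
  obtain ⟨V, hV, hVa, hVb⟩ := hex.choose_spec (e₀.symmL ℝ (γ a) w)
  rw [hab] at hV
  have h1 := norm_sub_le_of_hasDerivWithinAt_linear (w := fun t => (e₀ (V t)).2) (G := G)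
    (fun t ht => by
      rw [← hGγ t ht]
      exact hV.hasDerivWithinAt ht (hs t ht) (hbase t ht)) hG hK ha hb
  simp only [hVa, hVb] at h1
  rwa [trivializationAt_symmL_snd (hbase a ha)] at h1

end ParallelTransport

theorem ContinuousOn.clm_flip_apply {X F G H : Type*} [TopologicalSpace X] [NormedAddCommGroup F]
    [NormedSpace ℝ F] [NormedAddCommGroup G] [NormedSpace ℝ G] [NormedAddCommGroup H]
    [NormedSpace ℝ H] {B : X → F →L[ℝ] G →L[ℝ] H} {v : X → G} {s : Set X} (hB : ContinuousOn B s)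
    (hv : ContinuousOn v s) : ContinuousOn (fun x => (B x).flip (v x)) s :=
  ((ContinuousLinearMap.flipₗᵢ ℝ F G H).continuous.comp_continuousOn hB).clm_apply hv

section ParallelTransport

variable {E : Type*} [NormedAddCommGroup E] [NormedSpace ℝ E] [FiniteDimensional ℝ E]
  {M : Type*} [TopologicalSpace M] [ChartedSpace E M] [IsManifold 𝓘(ℝ, E) ∞ M]
  [RiemannianBundle (fun x : M => TangentSpace 𝓘(ℝ, E) x)]
  [IsContMDiffRiemannianBundle 𝓘(ℝ, E) ∞ E (fun x : M => TangentSpace 𝓘(ℝ, E) x)]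
  [T2Space M]

/-- Parallel transport along short geodesic segments from `p₀`, in both directions, is close to the
identity in the frame of the chart at `p₀`. -/
theorem eventually_norm_parallelTransport_sub_le (hM : IsGeodesicallyComplete E M) (p₀ : M)
    {ε : ℝ} (hε : 0 < ε) : ∀ᶠ p in 𝓝 p₀,
      (∀ w, ‖(trivializationAt E (TangentSpace 𝓘(ℝ, E)) p₀ ⟨p,
        parallelTransport E (normalGeodesic E p₀ p) 0 1 p₀ p
        ((trivializationAt E (TangentSpace 𝓘(ℝ, E)) p₀).symmL ℝ p₀ w)⟩).2 - w‖ ≤ ε * ‖w‖) ∧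
      ∀ w, ‖(trivializationAt E (TangentSpace 𝓘(ℝ, E)) p₀ ⟨p₀,
        parallelTransport E (normalGeodesic E p₀ p) 1 0 p p₀
        ((trivializationAt E (TangentSpace 𝓘(ℝ, E)) p₀).symmL ℝ p w)⟩).2 - w‖ ≤ ε * ‖w‖ := by
  obtain ⟨-, Ψ, h0, hΨt, hΨ, g, hg, hev⟩ := exists_normalGeodesic_eq (E := E) hM p₀
  set e₀ := trivializationAt E (TangentSpace 𝓘(ℝ, E)) p₀ with he₀
  have hbase : e₀.baseSet = (chartAt E p₀).source := by
    rw [he₀, TangentBundle.trivializationAt_baseSet]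
  have hd : ContinuousOn (fderiv ℝ Ψ) Ψ.source :=
    hΨ.continuousOn_fderiv_of_isOpen Ψ.open_source (by simp)
  have hΓ : ContinuousOn (fun z => christoffel E p₀ ((chartAt E p₀).symm z))
      (chartAt E p₀).target := by
    simpa [mfld_simps] using (contDiffOn_christoffel (E := E) p₀).continuousOn
  -- `H (t • ξ, ξ)` is the coefficient of the transport equation along `t ↦ Ψ (t • ξ)`. It is
  -- continuous and vanishes at the origin, hence small uniformly in `t` for small `ξ`.
  set H : E × E → E →L[ℝ] E := fun x =>
    (christoffel E p₀ ((chartAt E p₀).symm (Ψ x.1))).flip (fderiv ℝ Ψ x.1 x.2) with hH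
  have hHc : ContinuousOn H (Ψ.source ×ˢ univ) := by
    refine ContinuousOn.clm_flip_apply ?_ ?_
    · exact hΓ.comp (Ψ.continuousOn.comp continuousOn_fst fun x hx => hx.1)
        fun x hx => hΨt (Ψ.map_source hx.1)
    · exact (hd.comp continuousOn_fst fun x hx => hx.1).clm_apply continuousOn_snd
  -- The transport estimate has factor `2 * K` and requires `K ≤ 1 / 2`.
  set K := min (ε / 2) (1 / 2) with hK
  have hK0 : 0 < K := by positivity
  obtain ⟨δ, hδ, hδK⟩ : ∃ δ > 0, ∀ η ξ : E, ‖η‖ < δ → ‖ξ‖ < δ → ‖H (η, ξ)‖ ≤ K := by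
    have h1 : ContinuousAt H (0, 0) := hHc.continuousAt
      ((Ψ.open_source.prod isOpen_univ).mem_nhds ⟨h0, mem_univ _⟩)
    have h2 : H (0, 0) = 0 := by simp [hH]
    obtain ⟨δ, hδ, h3⟩ := Metric.continuousAt_iff.1 h1 K hK0
    refine ⟨δ, hδ, fun η ξ hη hξ => ?_⟩
    have h4 := @h3 (η, ξ) (by
      rw [dist_eq_norm, Prod.mk_zero_zero, sub_zero]
      exact max_lt hη hξ)
    rw [h2, dist_zero_right] at h4
    exact h4.le
  filter_upwards [hev, hg (Metric.ball_mem_nhds _ hδ)] with p ⟨hp0, hp1, hp⟩ hpδ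
  rw [mem_preimage, mem_ball_zero_iff] at hpδ
  set γ := normalGeodesic E p₀ p with hγ
  have hcm : ∀ t ∈ Icc (0 : ℝ) 1, Ψ (t • g p) ∈ (chartAt E p₀).target :=
    fun t ht => hΨt (Ψ.map_source (hp t ht).1)
  have hcd : ∀ t ∈ Icc (0 : ℝ) 1,
      HasDerivWithinAt (fun t => Ψ (t • g p)) (fderiv ℝ Ψ (t • g p) (g p)) (Icc 0 1) t := by
    intro t ht
    have h1 := ((hΨ.contDiffAt (Ψ.open_source.mem_nhds (hp t ht).1)).differentiableAt
      (by simp)).hasFDerivAt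
    have h2 : HasDerivAt (fun t : ℝ => t • g p) (g p) t := by
      simpa using (hasDerivAt_id t).smul_const (g p)
    exact (h1.comp_hasDerivAt t h2).hasDerivWithinAt
  have hγM : MDifferentiableOn 𝓘(ℝ, ℝ) 𝓘(ℝ, E) γ (Icc 0 1) := by
    intro t ht
    have h1 : MDifferentiableAt 𝓘(ℝ, E) 𝓘(ℝ, E) (chartAt E p₀).symm (Ψ (t • g p)) :=
      mdifferentiableAt_atlas_symm (chart_mem_atlas E p₀) (hcm t ht)
    have h2 := (hcd t ht).differentiableWithinAt.mdifferentiableWithinAt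
    exact (h1.comp_mdifferentiableWithinAt t h2).congr (fun s hs => (hp s hs).2) (hp t ht).2
  have hγb : ∀ t ∈ Icc (0 : ℝ) 1, γ t ∈ e₀.baseSet := by
    intro t ht
    rw [hbase, (hp t ht).2]
    exact (chartAt E p₀).map_target (hcm t ht)
  have hvel : ∀ t ∈ Icc (0 : ℝ) 1, (e₀ (velocityWithin E γ (Icc 0 1) t)).2 =
      fderiv ℝ Ψ (t • g p) (g p) := by
    intro t ht
    have h1 := hasDerivWithinAt_extChartAt_comp (hγM t ht) (hγb t ht)
    have h2 : ∀ s ∈ Icc (0 : ℝ) 1, extChartAt 𝓘(ℝ, E) p₀ (γ s) = Ψ (s • g p) := by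
      intro s hs
      rw [(hp s hs).2]
      simpa [mfld_simps] using (chartAt E p₀).right_inv (hcm s hs)
    exact (uniqueDiffOn_Icc one_pos t ht).eq_deriv _ h1
      ((hcd t ht).congr h2 (h2 t ht))
  have hGc : ContinuousOn (fun t : ℝ => H (t • g p, g p)) (Icc 0 1) :=
    hHc.comp (by fun_prop) fun t ht => ⟨(hp t ht).1, mem_univ _⟩
  have hGγ : ∀ t ∈ Icc (0 : ℝ) 1, ∀ w, christoffel E p₀ (γ t) w
      (e₀ (velocityWithin E γ (Icc 0 1) t)).2 = H (t • g p, g p) w := by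
    intro t ht w
    rw [hvel t ht, (hp t ht).2]
    rfl
  have hGK : ∀ t ∈ Icc (0 : ℝ) 1, ‖H (t • g p, g p)‖ ≤ K := by
    intro t ht
    refine hδK _ _ ?_ hpδ
    rw [norm_smul, Real.norm_of_nonneg ht.1]
    exact (mul_le_of_le_one_left (norm_nonneg _) ht.2).trans_lt hpδ
  have hKε : 2 * K ≤ ε := by linarith [min_le_left (ε / 2) (1 / 2)]
  have hKh : K ≤ 1 / 2 := min_le_right _ _
  constructor
  · intro w
    exact (norm_parallelTransport_sub_le hγM hγb hGc hGγ hGK hKh (uIcc_of_le zero_le_one) hp0 hp1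
      w).trans (mul_le_mul_of_nonneg_right hKε (norm_nonneg _))
  · intro w
    exact (norm_parallelTransport_sub_le hγM hγb hGc hGγ hGK hKh (uIcc_of_ge zero_le_one) hp1 hp0
      w).trans (mul_le_mul_of_nonneg_right hKε (norm_nonneg _))

end ParallelTransport

/-! ### Norms of operators and inverses under change of frame. -/

section Conjugation

variable {E F G : Type*} [NormedAddCommGroup E] [NormedSpace ℝ E] [NormedAddCommGroup F]
  [NormedSpace ℝ F] [NormedAddCommGroup G] [NormedSpace ℝ G]

theorem tendsto_id_of_norm_sub_le {α : Type*} {l : Filter α} {T : α → E →L[ℝ] E}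
    (h : ∀ ε > 0, ∀ᶠ a in l, ∀ w, ‖T a w - w‖ ≤ ε * ‖w‖) :
    Tendsto T l (𝓝 (ContinuousLinearMap.id ℝ E)) := by
  rw [Metric.tendsto_nhds]
  intro ε hε
  filter_upwards [h (ε / 2) (half_pos hε)] with a ha
  rw [dist_eq_norm]
  exact (ContinuousLinearMap.opNorm_le_bound _ (half_pos hε).le ha).trans_lt (half_lt_self hε)

theorem Filter.Tendsto.continuousLinearMap_comp {α : Type*} {l : Filter α} {S : α → F →L[ℝ] G}
    {S₀ : F →L[ℝ] G} {T : α → E →L[ℝ] F} {T₀ : E →L[ℝ] F} (hS : Tendsto S l (𝓝 S₀))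
    (hT : Tendsto T l (𝓝 T₀)) : Tendsto (fun a => S a ∘L T a) l (𝓝 (S₀ ∘L T₀)) :=
  ((continuous_fst.clm_comp continuous_snd).tendsto (S₀, T₀)).comp (hS.prodMk_nhds hT)

theorem tendsto_conj {α : Type*} {l : Filter α} (L : F ≃L[ℝ] E) {T : α → E →L[ℝ] E}
    {T₀ : E →L[ℝ] E} (h : Tendsto T l (𝓝 T₀)) :
    Tendsto (fun a => (L.symm : E →L[ℝ] F) ∘L T a ∘L (L : F →L[ℝ] E)) l
      (𝓝 ((L.symm : E →L[ℝ] F) ∘L T₀ ∘L (L : F →L[ℝ] E))) :=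
  tendsto_const_nhds.continuousLinearMap_comp (h.continuousLinearMap_comp tendsto_const_nhds)

theorem inverse_conj {L : G ≃L[ℝ] E} {A : G →L[ℝ] G} (hA : A.IsInvertible) :
    ((L : G →L[ℝ] E) ∘L A ∘L (L.symm : E →L[ℝ] G)).inverse =
      (L : G →L[ℝ] E) ∘L A.inverse ∘L (L.symm : E →L[ℝ] G) := by
  obtain ⟨D, rfl⟩ := hA
  have h : (L : G →L[ℝ] E) ∘L (D : G →L[ℝ] G) ∘L (L.symm : E →L[ℝ] G) =
      ((L.symm.trans D).trans L : E ≃L[ℝ] E) := rfl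
  rw [h, ContinuousLinearMap.inverse_equiv, ContinuousLinearMap.inverse_equiv]
  rfl

/-- With `L` and `L'` the frames at `p₀` and `p`, the inverse factors as `(L'⁻¹ L)(L⁻¹ T⁻¹ L)(L⁻¹
L')`. The middle factor acts on the fixed space `F`; the outer ones compare the norms of the two
tangent spaces. -/
theorem norm_inverse_le_of_conj {L : F ≃L[ℝ] E} {L' : G ≃L[ℝ] E} {A : G →L[ℝ] G} (hA : A.IsInvertible)
    {T : E →L[ℝ] E} (hT : T = (L' : G →L[ℝ] E) ∘L A ∘L (L'.symm : E →L[ℝ] G)) :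
    ‖A.inverse‖ ≤ ‖(L'.symm : E →L[ℝ] G) ∘L (L : F →L[ℝ] E)‖ *
      (‖(L.symm : E →L[ℝ] F) ∘L T.inverse ∘L (L : F →L[ℝ] E)‖ *
        ‖(L.symm : E →L[ℝ] F) ∘L (L' : G →L[ℝ] E)‖) := by
  have h : A.inverse = ((L'.symm : E →L[ℝ] G) ∘L (L : F →L[ℝ] E)) ∘L
      (((L.symm : E →L[ℝ] F) ∘L T.inverse ∘L (L : F →L[ℝ] E)) ∘L
        ((L.symm : E →L[ℝ] F) ∘L (L' : G →L[ℝ] E))) := by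
    rw [hT, inverse_conj hA]
    ext v
    simp
  rw [h]
  refine (ContinuousLinearMap.opNorm_comp_le _ _).trans ?_
  gcongr
  exact ContinuousLinearMap.opNorm_comp_le _ _

/-- The norms tend to `‖A₀.inverse‖`, and `5 / 4` leaves strict room above the limit only when the
limit is nonzero. -/
theorem eventually_norm_conj_inverse_le {α : Type*} {l : Filter α} (L : F ≃L[ℝ] E)
    {A₀ : F →L[ℝ] F} (hA₀ : A₀.IsInvertible) {T : α → E →L[ℝ] E}
    (h : Tendsto T l (𝓝 ((L : F →L[ℝ] E) ∘L A₀ ∘L (L.symm : E →L[ℝ] F)).inverse)) :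
    ∀ᶠ a in l, ‖A₀.inverse‖ ≠ 0 →
      ‖(L.symm : E →L[ℝ] F) ∘L T a ∘L (L : F →L[ℝ] E)‖ ≤ 5 / 4 * ‖A₀.inverse‖ := by
  have h1 := (tendsto_conj L h).norm
  have h2 : (L.symm : E →L[ℝ] F) ∘L ((L : F →L[ℝ] E) ∘L A₀ ∘L (L.symm : E →L[ℝ] F)).inverse ∘L
      (L : F →L[ℝ] E) = A₀.inverse := by
    rw [inverse_conj hA₀]
    ext v
    simp
  rw [h2] at h1
  by_cases h0 : ‖A₀.inverse‖ = 0
  · exact Eventually.of_forall fun p h => absurd h0 h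
  · have hpos : 0 < ‖A₀.inverse‖ := lt_of_le_of_ne (norm_nonneg _) (Ne.symm h0)
    exact (h1.eventually_le_const (by linarith)).mono fun p hp _ => hp

theorem norm_inverse_le_two_mul {L : F ≃L[ℝ] E} {L' : G ≃L[ℝ] E} {A₀ : F →L[ℝ] F}
    (hA₀ : A₀.IsInvertible) {A : G →L[ℝ] G} (hA : A.IsInvertible) {T : E →L[ℝ] E}
    (hT : T = (L' : G →L[ℝ] E) ∘L A ∘L (L'.symm : E →L[ℝ] G))
    (h : ‖A₀.inverse‖ ≠ 0 →
      ‖(L.symm : E →L[ℝ] F) ∘L T.inverse ∘L (L : F →L[ℝ] E)‖ ≤ 5 / 4 * ‖A₀.inverse‖)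
    (h1 : ‖(L.symm : E →L[ℝ] F) ∘L (L' : G →L[ℝ] E)‖ ≤ 6 / 5)
    (h2 : ‖(L'.symm : E →L[ℝ] G) ∘L (L : F →L[ℝ] E)‖ ≤ 6 / 5) :
    ‖A.inverse‖ ≤ 2 * ‖A₀.inverse‖ := by
  -- An invertible operator has zero inverse only on the trivial space; then `G`, isomorphic to `F`,
  -- is trivial as well.
  by_cases h0 : ‖A₀.inverse‖ = 0
  · have hF : Subsingleton F := by
      refine subsingleton_of_forall_eq 0 fun v => ?_
      obtain ⟨D, rfl⟩ := hA₀
      rw [norm_eq_zero, ContinuousLinearMap.inverse_equiv] at h0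
      simpa using congrArg (fun T : F →L[ℝ] F => T (D v)) h0
    have hG : Subsingleton G := (L'.trans L.symm).injective.subsingleton
    rw [Subsingleton.elim A.inverse 0, norm_zero]
    positivity
  · refine (norm_inverse_le_of_conj (L := L) hA hT).trans ?_
    -- The product of the three constants is `9 / 5 < 2`.
    calc _ ≤ 6 / 5 * ((5 / 4 * ‖A₀.inverse‖) * (6 / 5)) := by
          gcongr
          exact h h0
      _ ≤ 2 * ‖A₀.inverse‖ := by linarith [norm_nonneg A₀.inverse]

theorem isInvertible_conj_iff {L : G ≃L[ℝ] E} {A : G →L[ℝ] G} :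
    ((L : G →L[ℝ] E) ∘L A ∘L (L.symm : E →L[ℝ] G)).IsInvertible ↔ A.IsInvertible := by
  constructor
  · rintro ⟨D, hD⟩
    refine ⟨(L.trans D).trans L.symm, ?_⟩
    ext v
    have h := congrArg (fun T : E →L[ℝ] E => L.symm (T (L v))) hD
    simpa using h
  · rintro ⟨D, rfl⟩
    exact ⟨(L.symm.trans D).trans L, rfl⟩

end Conjugation

theorem ContinuousLinearMap.IsInvertible.tendsto_inverse {E : Type*} [NormedAddCommGroup E]
    [NormedSpace ℝ E] [CompleteSpace E] {α : Type*} {l : Filter α} {T : α → E →L[ℝ] E}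
    {T₀ : E →L[ℝ] E} (h₀ : T₀.IsInvertible) (h : Tendsto T l (𝓝 T₀)) :
    (∀ᶠ a in l, (T a).IsInvertible) ∧
      Tendsto (fun a => (T a).inverse) l (𝓝 T₀.inverse) := by
  obtain ⟨D, rfl⟩ := h₀
  refine ⟨h (ContinuousLinearEquiv.nhds D), ?_⟩
  exact ((isInvertible_equiv (f := D)).contDiffAt_map_inverse (n := 0)).continuousAt.tendsto.comp h

/-! ### Limits in the frame of the chart at the base point. -/

section FrameOfChart

variable {E : Type*} [NormedAddCommGroup E] [NormedSpace ℝ E] [FiniteDimensional ℝ E]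
  {M : Type*} [TopologicalSpace M] [ChartedSpace E M] [IsManifold 𝓘(ℝ, E) ∞ M]

theorem tendsto_inCoordinates {A : Π x : M, TangentSpace 𝓘(ℝ, E) x →L[ℝ] TangentSpace 𝓘(ℝ, E) x}
    {p₀ : M} (hA : ContinuousAt
      (fun p => (⟨p, A p⟩ : TotalSpace (E →L[ℝ] E)
        (fun x : M => TangentSpace 𝓘(ℝ, E) x →L[ℝ] TangentSpace 𝓘(ℝ, E) x))) p₀) :
    Tendsto (fun p => ContinuousLinearMap.inCoordinates E (TangentSpace 𝓘(ℝ, E)) E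
      (TangentSpace 𝓘(ℝ, E)) p₀ p p₀ p (A p)) (𝓝 p₀)
      (𝓝 (ContinuousLinearMap.inCoordinates E (TangentSpace 𝓘(ℝ, E)) E
      (TangentSpace 𝓘(ℝ, E)) p₀ p₀ p₀ p₀ (A p₀))) :=
  ((continuousAt_hom_bundle (RingHom.id ℝ) _).1 hA).2

variable [RiemannianBundle (fun x : M => TangentSpace 𝓘(ℝ, E) x)]
  [IsContMDiffRiemannianBundle 𝓘(ℝ, E) ∞ E (fun x : M => TangentSpace 𝓘(ℝ, E) x)]

/-- In the frame the two transports tend to the identity and `A p` to `A p₀`. Near `p₀` the frame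
maps at `p` cancel in the product, and conjugation by the fixed frame at `p₀` returns the limit to
the Riemannian operator norm there. -/
theorem tendsto_norm_parallelTransport_conj_sub [T2Space M] (hM : IsGeodesicallyComplete E M)
    {A : Π x : M, TangentSpace 𝓘(ℝ, E) x →L[ℝ] TangentSpace 𝓘(ℝ, E) x} {p₀ : M}
    (hA : ContinuousAt
      (fun p => (⟨p, A p⟩ : TotalSpace (E →L[ℝ] E)
        (fun x : M => TangentSpace 𝓘(ℝ, E) x →L[ℝ] TangentSpace 𝓘(ℝ, E) x))) p₀) :
    Tendsto
      (fun p => ‖(parallelTransport E (normalGeodesic E p₀ p) 1 0 p p₀ ∘L A p ∘L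
        parallelTransport E (normalGeodesic E p₀ p) 0 1 p₀ p) - A p₀‖)
      (𝓝 p₀) (𝓝 0) := by
  set e₀ := trivializationAt E (TangentSpace 𝓘(ℝ, E)) p₀ with he₀
  have hp₀ : p₀ ∈ e₀.baseSet := FiberBundle.mem_baseSet_trivializationAt' p₀
  set L := tangentCoords E p₀ with hL
  have hQ : Tendsto (fun p => e₀.continuousLinearMapAt ℝ p ∘L
      parallelTransport E (normalGeodesic E p₀ p) 0 1 p₀ p ∘L e₀.symmL ℝ p₀) (𝓝 p₀)
      (𝓝 (ContinuousLinearMap.id ℝ E)) := by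
    refine tendsto_id_of_norm_sub_le fun ε hε => ?_
    filter_upwards [eventually_norm_parallelTransport_sub_le hM p₀ hε,
      e₀.open_baseSet.mem_nhds hp₀] with p hp hpb w
    rw [ContinuousLinearMap.comp_apply, e₀.continuousLinearMapAt_apply_of_mem ℝ hpb]
    exact hp.1 w
  have hR : Tendsto (fun p => e₀.continuousLinearMapAt ℝ p₀ ∘L
      parallelTransport E (normalGeodesic E p₀ p) 1 0 p p₀ ∘L e₀.symmL ℝ p) (𝓝 p₀)
      (𝓝 (ContinuousLinearMap.id ℝ E)) := by
    refine tendsto_id_of_norm_sub_le fun ε hε => ?_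
    filter_upwards [eventually_norm_parallelTransport_sub_le hM p₀ hε] with p hp w
    rw [ContinuousLinearMap.comp_apply, e₀.continuousLinearMapAt_apply_of_mem ℝ hp₀]
    exact hp.2 w
  have h1 := tendsto_conj L (hR.continuousLinearMap_comp
    ((tendsto_inCoordinates hA).continuousLinearMap_comp hQ))
  rw [ContinuousLinearMap.id_comp, ContinuousLinearMap.comp_id] at h1
  have hL₁ : ∀ v, e₀.symmL ℝ p₀ (L v) = v := by
    intro v
    have h := e₀.symmL_continuousLinearMapAt (R := ℝ) hp₀ v
    rwa [e₀.continuousLinearMapAt_apply_of_mem ℝ hp₀] at h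
  have hL₂ : ∀ v, L.symm (e₀.continuousLinearMapAt ℝ p₀ v) = v := by
    intro v
    rw [e₀.continuousLinearMapAt_apply_of_mem ℝ hp₀]
    exact L.symm_apply_apply v
  have h2 := (h1.sub_const (A p₀)).norm
  have h3 : (L.symm : E →L[ℝ] TangentSpace 𝓘(ℝ, E) p₀) ∘L
      ContinuousLinearMap.inCoordinates E (TangentSpace 𝓘(ℝ, E)) E (TangentSpace 𝓘(ℝ, E))
        p₀ p₀ p₀ p₀ (A p₀) ∘L (L : TangentSpace 𝓘(ℝ, E) p₀ →L[ℝ] E) = A p₀ := by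
    ext v
    simp only [ContinuousLinearMap.comp_apply, ContinuousLinearMap.inCoordinates,
      ContinuousLinearEquiv.coe_coe]
    rw [hL₂, hL₁]
  rw [h3, sub_self, norm_zero] at h2
  refine h2.congr' ?_
  filter_upwards [e₀.open_baseSet.mem_nhds hp₀] with p hp
  congr 2
  ext v
  simp only [ContinuousLinearMap.comp_apply, ContinuousLinearMap.inCoordinates,
    ContinuousLinearEquiv.coe_coe]
  rw [hL₂, hL₁, e₀.symmL_continuousLinearMapAt hp, e₀.symmL_continuousLinearMapAt hp]

theorem isContinuousRiemannianBundle_tangentSpace :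
    IsContinuousRiemannianBundle E (fun x : M => TangentSpace 𝓘(ℝ, E) x) := by
  obtain ⟨g, hg, h⟩ := IsContMDiffRiemannianBundle.exists_contMDiff (IB := 𝓘(ℝ, E)) (n := ∞)
    (F := E) (E := fun x : M => TangentSpace 𝓘(ℝ, E) x)
  exact ⟨g, hg.continuous, h⟩

/-- Openness of invertibility and continuity of inversion are used in the fixed space `E`.
Continuity of the metric makes both comparison maps between the tangent spaces at `p` and `p₀` have
norm below `6 / 5`. -/
theorem eventually_isInvertible_norm_inverse_le
    {A : Π x : M, TangentSpace 𝓘(ℝ, E) x →L[ℝ] TangentSpace 𝓘(ℝ, E) x} {p₀ : M}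
    (hA : ContinuousAt
      (fun p => (⟨p, A p⟩ : TotalSpace (E →L[ℝ] E)
        (fun x : M => TangentSpace 𝓘(ℝ, E) x →L[ℝ] TangentSpace 𝓘(ℝ, E) x))) p₀)
    (hinv : (A p₀).IsInvertible) :
    ∀ᶠ p in 𝓝 p₀, (A p).IsInvertible ∧ ‖(A p).inverse‖ ≤ 2 * ‖(A p₀).inverse‖ := by
  have : IsContinuousRiemannianBundle E (fun x : M => TangentSpace 𝓘(ℝ, E) x) :=
    isContinuousRiemannianBundle_tangentSpace
  set e₀ := trivializationAt E (TangentSpace 𝓘(ℝ, E)) p₀ with he₀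
  have hp₀ : p₀ ∈ e₀.baseSet := FiberBundle.mem_baseSet_trivializationAt' p₀
  set B := fun p => ContinuousLinearMap.inCoordinates E (TangentSpace 𝓘(ℝ, E)) E
      (TangentSpace 𝓘(ℝ, E)) p₀ p p₀ p (A p) with hB
  set L := tangentCoords E p₀ with hL
  have hBp : ∀ p (hp : p ∈ e₀.baseSet), B p =
      (e₀.continuousLinearEquivAt ℝ p hp : TangentSpace 𝓘(ℝ, E) p →L[ℝ] E) ∘L A p ∘L
        ((e₀.continuousLinearEquivAt ℝ p hp).symm : E →L[ℝ] TangentSpace 𝓘(ℝ, E) p) :=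
    fun p hp => ContinuousLinearMap.inCoordinates_eq hp hp
  have hB₀ : (B p₀).IsInvertible := by
    rw [hBp p₀ hp₀]
    exact isInvertible_conj_iff.2 hinv
  obtain ⟨h1, h2⟩ := hB₀.tendsto_inverse (tendsto_inCoordinates hA)
  have h3 := eventually_norm_conj_inverse_le L hinv (hBp p₀ hp₀ ▸ h2)
  filter_upwards [e₀.open_baseSet.mem_nhds hp₀, h1, h3,
    eventually_norm_symmL_trivializationAt_self_comp_lt E
      (fun x : M => TangentSpace 𝓘(ℝ, E) x) p₀ (r := 6 / 5) (by norm_num),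
    eventually_norm_symmL_trivializationAt_comp_self_lt E
      (fun x : M => TangentSpace 𝓘(ℝ, E) x) p₀ (r := 6 / 5) (by norm_num)]
    with p hp hpinv hpB hp1 hp2
  have hAinv : (A p).IsInvertible := by
    have h : (B p).IsInvertible := hpinv
    rw [hBp p hp] at h
    exact isInvertible_conj_iff.1 h
  refine ⟨hAinv, norm_inverse_le_two_mul (L := L) (L' := e₀.continuousLinearEquivAt ℝ p hp) hinv
    hAinv (hBp p hp) hpB (le_of_eq_of_le (congrArg norm ?_) hp1.le)
    (le_of_eq_of_le (congrArg norm ?_) hp2.le)⟩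
  · ext v
    change _ = e₀.symmL ℝ p₀ (e₀.continuousLinearMapAt ℝ p v)
    rw [e₀.continuousLinearMapAt_apply_of_mem ℝ hp, e₀.symmL_apply hp₀]
    rfl
  · ext v
    change _ = e₀.symmL ℝ p (e₀.continuousLinearMapAt ℝ p₀ v)
    rw [e₀.continuousLinearMapAt_apply_of_mem ℝ hp₀, e₀.symmL_apply hp]
    rfl

end FrameOfChart

theorem mainTheorem4
    {E : Type*} [NormedAddCommGroup E] [NormedSpace ℝ E] [FiniteDimensional ℝ E]
    {M : Type*} [MetricSpace M] [ChartedSpace E M] [IsManifold 𝓘(ℝ, E) ∞ M]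
    [RiemannianBundle (fun x : M => TangentSpace 𝓘(ℝ, E) x)]
    [IsContMDiffRiemannianBundle 𝓘(ℝ, E) ∞ E (fun x : M => TangentSpace 𝓘(ℝ, E) x)]
    [IsRiemannianManifold 𝓘(ℝ, E) M]
    (hM : IsGeodesicallyComplete E M)
    (Ω : Set M) (hΩ : IsOpen Ω)
    (X : Π x : M, TangentSpace 𝓘(ℝ, E) x)
    (hX : ∀ p ∈ Ω, MDifferentiableAt 𝓘(ℝ, E) 𝓘(ℝ, E).tangent
      (fun x => (⟨x, X x⟩ : TangentBundle 𝓘(ℝ, E) M)) p)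
    (p₀ : M) (hp₀ : p₀ ∈ Ω)
    (hcont : ContinuousAt
      (fun p => (⟨p, leviCivita E M X p⟩ : TotalSpace (E →L[ℝ] E)
        (fun x : M => TangentSpace 𝓘(ℝ, E) x →L[ℝ] TangentSpace 𝓘(ℝ, E) x))) p₀) :
    Tendsto
      (fun p => ‖(parallelTransport E (normalGeodesic E p₀ p) 1 0 p p₀ ∘L leviCivita E M X p ∘L
        parallelTransport E (normalGeodesic E p₀ p) 0 1 p₀ p) - leviCivita E M X p₀‖)
      (𝓝 p₀) (𝓝 0) ∧
    ((leviCivita E M X p₀).IsInvertible →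
      ∃ δ : ℝ, 0 < δ ∧ ENNReal.ofReal δ < injectivityRadius E p₀ ∧ Metric.ball p₀ δ ⊆ Ω ∧
        ∀ p ∈ Metric.ball p₀ δ, (leviCivita E M X p).IsInvertible ∧
          ‖(leviCivita E M X p).inverse‖ ≤ 2 * ‖(leviCivita E M X p₀).inverse‖) := by
  refine ⟨tendsto_norm_parallelTransport_conj_sub hM hcont, fun hinv => ?_⟩
  -- The injectivity radius is positive but possibly infinite, so a real number strictly between `0`
  -- and it is taken.
  obtain ⟨ρ, hρ0, hρ⟩ := ENNReal.lt_iff_exists_real_btwn.1 (exists_normalGeodesic_eq (E := E) hM p₀).1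
  obtain ⟨hρ1, hρ2⟩ := hρ
  obtain ⟨ρ', hρ', h⟩ := Metric.eventually_nhds_iff_ball.1
    ((eventually_isInvertible_norm_inverse_le hcont hinv).and (hΩ.mem_nhds hp₀))
  refine ⟨min ρ ρ', lt_min (ENNReal.ofReal_pos.1 hρ1) hρ',
    (ENNReal.ofReal_le_ofReal (min_le_left _ _)).trans_lt hρ2, fun p hp => ?_, fun p hp => ?_⟩
  · exact (h p (Metric.ball_subset_ball (min_le_right _ _) hp)).2
  · exact (h p (Metric.ball_subset_ball (min_le_right _ _) hp)).1
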